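/- \textbf{Theorem (explicit stochastic factorization of the type I hypergeometric Markov matrix).} Let $a,b>0$, $d>\max(a,b)$, $c\ge a$, $c+1\ge b$ and $c-b\notin\{0,-1,-2,\dots\}$, and put $\delta:=c+d-a-b$ (so $c,\delta>0$). All matrices below are semi-infinite, with rows and columns indexed by $\mathbb N_0=\{0,1,2,\dots\}$. \emph{Setting.} On $[0,1]$ consider $$w_1(x)={}_2F_1\left[{c-b,\,d-b\atop \delta};1-x\right],\qquad w_2(x)=\frac cb\,{}_2F_1\left[{c-b,\,d-b-1\atop \delta};1-x\right],$$ $$d\mu(x)=\frac{\Gamma(c)\Gamma(d)}{\Gamma(a)\Gamma(b)\Gamma(\delta)}x^{a-1}(1-x)^{\delta-1}\,dx .$$ Let $X=(1,x,x^2,\dots)^\top$, $X_1=(1,0,x,0,x^2,0,\dots)^\top$, $X_2=(0,1,0,x,0,x^2,\dots)^\top$, $\xi=X_1w_1+X_2w_2$, and let $g=\int X\xi^\top d\mu$ be the moment matrix. A Gauss--Borel factorization of $g$ is $g=S^{-1}H\tilde S^{-\top}$ with $S,\tilde S$ lower unitriangular and $H$ diagonal with nonzero diagonal entries. Given one, let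 $\Lambda$ be the matrix with ones on the first superdiagonal and zeros elsewhere, let $J=S\Lambda S^{-1}$ be the Jacobi matrix, let $A_i=H^{-1}\tilde SX_i$ $(i=1,2)$ be the vectors of type I multiple orthogonal polynomials, and let $q^{(n)}=w_1A_1^{(n)}+w_2A_2^{(n)}$ be the type I linear forms. The type I Markov matrix is $$P_I=\sigma J^\top\sigma^{-1},\qquad \sigma=\operatorname{diag}\big(1/q^{(0)}(1),1/q^{(1)}(1),\dots\big).$$ With $c_{2k-1}=c+k$ and $c_{2k}=d+k$ $(k\in\mathbb N_0)$ put, for $n\in\mathbb N_0$, $$\lambda_{3n}=\tfrac{n(b+n-1)(c_n-a-1)}{(c_n+n-2)(c_n+n-1)(c_{n-1}+n-1)},\quad \lambda_{3n+1}=\tfrac{n(a+n)(c_{n-1}-b)}{(c_n+n-1)(c_{n-1}+n-1)(c_{n-1}+n)},\quad \lambda_{3n+2}=\tfrac{(a+n)(b+n)(c_n-1)}{(c_n+n-1)(c_n+n)(c_{n-1}+n)},$$ where $\lambda_2$ means $\frac{ab}{cd}$ (the common factor $d-1$ is cancelled, also if $d=1$), and $\lambda_0=\lambda_1=0$. Let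 $L_1$ (resp. $L_2$) be lower bidiagonal with ones on the diagonal and subdiagonal $\lambda_3,\lambda_6,\lambda_9,\dots$ (resp. $\lambda_4,\lambda_7,\lambda_{10},\dots$), and let $U$ be upper bidiagonal with diagonal $\lambda_2,\lambda_5,\lambda_8,\dots$ and ones on the superdiagonal. Put $D_i=\operatorname{diag}(1/d_i^{(0)},1/d_i^{(1)},\dots)$ with $$d_1^{(n)}=q^{(n)}(1)+\lambda_{3n+3}q^{(n+1)}(1),\qquad d_2^{(n)}=q^{(n)}(1)+(\lambda_{3n+3}+\lambda_{3n+4})q^{(n+1)}(1)+\lambda_{3n+4}\lambda_{3n+6}q^{(n+2)}(1),$$ and $$P_I^L=\sigma U^\top D_2^{-1},\qquad P_{I,2}^U=D_2L_2^\top D_1^{-1},\qquad P_{I,1}^U=D_1L_1^\top\sigma^{-1}.$$ \emph{Conclusion.} The moment matrix $g$ has exactly one Gauss--Borel factorization. The matrices $P_I$, $P_I^L$, $P_{I,2}^U$, $P_{I,1}^U$ are stochastic (nonnegative entries, all row sums equal to $1$), and $$P_I=P_I^L\,P_{I,2}^U\,P_{I,1}^U .$$ The matrix $P_I^L$ is of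 pure death type (only the diagonal and the first subdiagonal can be nonzero), while $P_{I,2}^U$ and $P_{I,1}^U$ are of pure birth type (only the diagonal and the first superdiagonal can be nonzero). The state $0$ is absorbing for $P_I^L$: $(P_I^L)_{0,0}=1$ and $(P_I^L)_{0,m}=0$ for $m\ne0$. The other entries are, for all $n\in\mathbb N_0$ (for $n\ge1$ in the first line), $$\begin{aligned} (P_I^L)_{2n,2n-1}&=\tfrac{2n}{3n-1+d},&(P_I^L)_{2n,2n}&=\tfrac{n-1+d}{3n-1+d},\\ (P_I^L)_{2n+1,2n}&=\tfrac{2n+1}{3n+1+c},&(P_I^L)_{2n+1,2n+1}&=\tfrac{n+c}{3n+1+c},\\ (P_{I,2}^U)_{2n,2n+1}&=\tfrac{n+d-b}{3n+d},&(P_{I,2}^U)_{2n,2n}&=\tfrac{2n+b}{3n+d},\\ (P_{I,2}^U)_{2n+1,2n+2}&=\tfrac{n+1+c-b}{3n+2+c},&(P_{I,2}^U)_{2n+1,2n+1}&=\tfrac{2n+1+b}{3n+2+c},\\ (P_{I,1}^U)_{2n,2n+1}&=\tfrac{n+c-a}{3n+c},&(P_{I,1}^U)_{2n,2n}&=\tfrac{2n+a}{3n+c},\\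 (P_{I,1}^U)_{2n+1,2n+2}&=\tfrac{n+d-a}{3n+1+d},&(P_{I,1}^U)_{2n+1,2n+1}&=\tfrac{2n+1+a}{3n+1+d}. \end{aligned}$$ -/

import Mathlib

open MeasureTheory

namespace HypMOP

noncomputable section

/-! ### Semi-infinite matrices -/

/-- Semi-infinite real matrices, with rows and columns indexed by `0, 1, 2, …`. -/
abbrev SMat := Matrix ℕ ℕ ℝ

/-- Product of semi-infinite matrices. (In every product below, each of these series has only
finitely many nonzero terms.) -/
def semiMul (A B : SMat) : SMat := fun n m => ∑' k, A n k * B k m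

infixl:70 " ⬝∞ " => semiMul

/-- Lower triangular with ones on the diagonal. -/
def IsLowerUnitri (S : SMat) : Prop :=
  (∀ n, S n n = 1) ∧ ∀ n m, n < m → S n m = 0

/-- The inverse `S⁻¹` of a lower unitriangular semi-infinite matrix `S`: its entries are the
entries of the inverses of the finite leading truncations of `S`. -/
def lowerInv (S : SMat) : SMat := fun n m =>
  if h : m ≤ n then
    (Matrix.of fun i j : Fin (n + 1) => S i j)⁻¹ (Fin.last n) ⟨m, Nat.lt_succ_of_le h⟩
  else 0

/-- The shift matrix, with ones on the first superdiagonal and zeros elsewhere. -/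
def shiftMat : SMat := fun n m => if m = n + 1 then 1 else 0

/-- A (row) stochastic semi-infinite matrix. -/
def IsStochastic (P : SMat) : Prop :=
  (∀ n m, 0 ≤ P n m) ∧ ∀ n, HasSum (fun m => P n m) 1

/-- Transition matrix of a pure birth chain: only the diagonal and the first superdiagonal may be
nonzero. -/
def IsPureBirth (P : SMat) : Prop :=
  IsStochastic P ∧ ∀ n m, m ≠ n → m ≠ n + 1 → P n m = 0

/-- Transition matrix of a pure death chain: only the diagonal and the first subdiagonal may be
nonzero. -/
def IsPureDeath (P : SMat) : Prop :=
  IsStochastic P ∧ ∀ n m, m ≠ n → m + 1 ≠ n → P n m = 0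

/-- The state `i` is absorbing: once reached, it is never left. -/
def IsAbsorbing (P : SMat) (i : ℕ) : Prop :=
  P i i = 1 ∧ ∀ m, m ≠ i → P i m = 0

/-! ### The hypergeometric system of weights on `[0,1]` -/

/-- `w₁(x) = ₂F₁(c - b, d - b; δ; 1 - x)` with `δ = c + d - a - b`. -/
def w₁ (a b c d x : ℝ) : ℝ :=
  ordinaryHypergeometric (c - b) (d - b) (c + d - a - b) (1 - x)

/-- `w₂(x) = (c / b) ₂F₁(c - b, d - b - 1; δ; 1 - x)` with `δ = c + d - a - b`. -/
def w₂ (a b c d x : ℝ) : ℝ :=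
  c / b * ordinaryHypergeometric (c - b) (d - b - 1) (c + d - a - b) (1 - x)

/-- The density `Γ(c)Γ(d) / (Γ(a)Γ(b)Γ(δ)) x^(a-1) (1-x)^(δ-1)`. -/
def density (a b c d x : ℝ) : ℝ :=
  Real.Gamma c * Real.Gamma d / (Real.Gamma a * Real.Gamma b * Real.Gamma (c + d - a - b)) *
    x ^ (a - 1) * (1 - x) ^ (c + d - a - b - 1)

/-- The measure `dμ(x) = density(x) dx` on the unit interval (whose endpoints are null sets). -/
def mu (a b c d : ℝ) : Measure ℝ :=
  (volume.restrict (Set.Ioo (0 : ℝ) 1)).withDensity fun x => ENNReal.ofReal (density a b c d x)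

/-! ### Moment matrix and Gauss–Borel factorization -/

/-- `X₁ = (1, 0, x, 0, x², 0, …)`. -/
def X₁ (x : ℝ) (j : ℕ) : ℝ := if j % 2 = 0 then x ^ (j / 2) else 0

/-- `X₂ = (0, 1, 0, x, 0, x², …)`. -/
def X₂ (x : ℝ) (j : ℕ) : ℝ := if j % 2 = 1 then x ^ (j / 2) else 0

/-- The undressed linear forms `ξ = X₁ w₁ + X₂ w₂ = (w₁, w₂, x w₁, x w₂, …)`. -/
def xi (a b c d x : ℝ) (j : ℕ) : ℝ := X₁ x j * w₁ a b c d x + X₂ x j * w₂ a b c d x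

/-- The moment matrix `g = ∫ X ξᵀ dμ`, where `X = (1, x, x², …)`. -/
def momentMatrix (a b c d : ℝ) : SMat := fun i j => ∫ x, x ^ i * xi a b c d x j ∂(mu a b c d)

/-- The data `S`, `H`, `S̃` of a Gauss–Borel factorization. -/
structure BorelData where
  S : SMat
  H : ℕ → ℝ
  St : SMat

/-- `g = S⁻¹ H S̃⁻ᵀ` with `S`, `S̃` lower unitriangular and `H` diagonal with nonzero entries. -/
def IsGaussBorel (g : SMat) (F : BorelData) : Prop :=
  IsLowerUnitri F.S ∧ IsLowerUnitri F.St ∧ (∀ n, F.H n ≠ 0) ∧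
    g = lowerInv F.S ⬝∞ Matrix.diagonal F.H ⬝∞ (lowerInv F.St).transpose

/-- The Jacobi matrix `J = S Λ S⁻¹`. -/
def jacobi (F : BorelData) : SMat := F.S ⬝∞ shiftMat ⬝∞ lowerInv F.S

/-- The type I multiple orthogonal polynomials `A₁ = H⁻¹ S̃ X₁`. -/
def A₁ (F : BorelData) (n : ℕ) (x : ℝ) : ℝ :=
  (F.H n)⁻¹ * ∑ j ∈ Finset.range (n + 1), F.St n j * X₁ x j

/-- The type I multiple orthogonal polynomials `A₂ = H⁻¹ S̃ X₂`. -/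
def A₂ (F : BorelData) (n : ℕ) (x : ℝ) : ℝ :=
  (F.H n)⁻¹ * ∑ j ∈ Finset.range (n + 1), F.St n j * X₂ x j

/-- The type I linear forms `q⁽ⁿ⁾ = w₁ A₁⁽ⁿ⁾ + w₂ A₂⁽ⁿ⁾`. -/
def q (a b c d : ℝ) (F : BorelData) (n : ℕ) (x : ℝ) : ℝ :=
  w₁ a b c d x * A₁ F n x + w₂ a b c d x * A₂ F n x

/-- The type I Markov matrix `P_I = σ Jᵀ σ⁻¹`, where `σ = diag (1 / q⁽ⁿ⁾(1))`. -/
def PI (a b c d : ℝ) (F : BorelData) : SMat := fun n m =>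
  q a b c d F m 1 / q a b c d F n 1 * jacobi F m n

/-! ### The coefficients `λ` and the three factors -/

/-- `cPrev c d n` is `c_{n-1}`, for the sequence `c_{2k-1} = c + k`, `c_{2k} = d + k` (`k ≥ 0`).
Hence `c_n` is `cPrev c d (n + 1)`. -/
def cPrev (c d : ℝ) (n : ℕ) : ℝ :=
  if n % 2 = 0 then c + (n / 2 : ℕ) else d + (n / 2 : ℕ)

/-- The coefficients `λ`. For `n ∈ ℕ`,
`λ_{3n} = n (b+n-1) (c_n-a-1) / ((c_n+n-2) (c_n+n-1) (c_{n-1}+n-1))`,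
`λ_{3n+1} = n (a+n) (c_{n-1}-b) / ((c_n+n-1) (c_{n-1}+n-1) (c_{n-1}+n))`,
`λ_{3n+2} = (a+n) (b+n) (c_n-1) / ((c_n+n-1) (c_n+n) (c_{n-1}+n))`.
At `n = 0` the common factor `c_0 - 1 = d - 1` of numerator and denominator of `λ_2` is cancelled,
so that `λ_2 = a b / (c d)` also when `d = 1`. -/
def lam (a b c d : ℝ) (m : ℕ) : ℝ :=
  let n : ℕ := m / 3
  let cn : ℝ := cPrev c d (n + 1)
  let cp : ℝ := cPrev c d n
  if m % 3 = 0 then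
    n * (b + n - 1) * (cn - a - 1) / ((cn + n - 2) * (cn + n - 1) * (cp + n - 1))
  else if m % 3 = 1 then
    n * (a + n) * (cp - b) / ((cn + n - 1) * (cp + n - 1) * (cp + n))
  else if n = 0 then a * b / (c * d)
  else (a + n) * (b + n) * (cn - 1) / ((cn + n - 1) * (cn + n) * (cp + n))

/-- Lower bidiagonal, ones on the diagonal, subdiagonal `λ₃, λ₆, λ₉, …`. -/
def L₁ (a b c d : ℝ) : SMat := fun n m =>
  if n = m then 1 else if n = m + 1 then lam a b c d (3 * m + 3) else 0

/-- Lower bidiagonal, ones on the diagonal, subdiagonal `λ₄, λ₇, λ₁₀, …`. -/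
def L₂ (a b c d : ℝ) : SMat := fun n m =>
  if n = m then 1 else if n = m + 1 then lam a b c d (3 * m + 4) else 0

/-- Upper bidiagonal, diagonal `λ₂, λ₅, λ₈, …`, ones on the superdiagonal. -/
def U (a b c d : ℝ) : SMat := fun n m =>
  if m = n then lam a b c d (3 * n + 2) else if m = n + 1 then 1 else 0

/-- `d_{I,1}⁽ⁿ⁾`. -/
def dI₁ (a b c d : ℝ) (F : BorelData) (n : ℕ) : ℝ :=
  q a b c d F n 1 + lam a b c d (3 * n + 3) * q a b c d F (n + 1) 1

/-- `d_{I,2}⁽ⁿ⁾`. -/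
def dI₂ (a b c d : ℝ) (F : BorelData) (n : ℕ) : ℝ :=
  q a b c d F n 1 + (lam a b c d (3 * n + 3) + lam a b c d (3 * n + 4)) * q a b c d F (n + 1) 1 +
    lam a b c d (3 * n + 4) * lam a b c d (3 * n + 6) * q a b c d F (n + 2) 1

/-- `P_I^L = σ Uᵀ D₂⁻¹`, where `σ = diag (1 / q⁽ⁿ⁾(1))` and `D₂ = diag (1 / d_{I,2}⁽ⁿ⁾)`. -/
def PIL (a b c d : ℝ) (F : BorelData) : SMat := fun n m =>
  1 / q a b c d F n 1 * (U a b c d).transpose n m * dI₂ a b c d F m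

/-- `P_{I,2}^U = D₂ L₂ᵀ D₁⁻¹`, where `Dᵢ = diag (1 / d_{I,i}⁽ⁿ⁾)`. -/
def PIU₂ (a b c d : ℝ) (F : BorelData) : SMat := fun n m =>
  1 / dI₂ a b c d F n * (L₂ a b c d).transpose n m * dI₁ a b c d F m

/-- `P_{I,1}^U = D₁ L₁ᵀ σ⁻¹`, where `σ = diag (1 / q⁽ⁿ⁾(1))` and `D₁ = diag (1 / d_{I,1}⁽ⁿ⁾)`. -/
def PIU₁ (a b c d : ℝ) (F : BorelData) : SMat := fun n m =>
  1 / dI₁ a b c d F n * (L₁ a b c d).transpose n m * q a b c d F m 1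

end

end HypMOP

open HypMOP

namespace HypMOP

/-! A Gauss–Borel factorization is an LU factorization, so at most one exists. It suffices to
exhibit a lower unitriangular `S` for which `S g` is upper triangular with nonzero diagonal, and
then to compute everything from that `S`.

Integrating the series of the weights termwise against Beta integrals and summing by Gauss's theorem
gives the moments `(a)_k (b)_k / ((c)_k (d)_k)` for `w₁`, and the same with `b + 1`, `c + 1` for
`w₂`. The rows of `S` are the monic polynomials proportional to `₃F₂(-n, c_{n-1}, c_n - 1; a, b;
x)`. Against such moments the Pochhammer quotients become polynomials in the summation index, so
below the diagonal one meets an `n`-th difference of a polynomial of degree less than `n`, which is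
zero (`sum_mopCoef_eq_zero`). On the diagonal one simple pole survives, and its residue is nonzero
under the hypotheses (`sum_mopCoef_ne_zero`).

Three contiguous relations factor multiplication by `x` on these polynomials: `L₁` undoes raising
`a`, `L₂` undoes raising `b`, and `U` expands `x` times the fully raised polynomial in the original
ones. Hence `J = L₁ L₂ U` (`factorized_semiMul_typeII`, `jacobi_eq`).

For the values `q⁽ⁿ⁾(1)` the explicit product `formOne` is taken as a row vector `v`. A direct
computation gives `v J = v`. Since `J (S g)` is `S g` moved by two columns, `v (S g)` has period
two, exactly like the vector `ξ(1) = (1, c/b, 1, c/b, …)`. Two initial entries agree, so `v (S g) =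
ξ(1)ᵀ`, and inverting `S g = H S̃⁻ᵀ` identifies `v` with `q(1)` (`q_one_eq`). The intermediate
vectors `v L₁` and `v L₁ L₂` are the normalizations `d₁` and `d₂`, with closed forms. The entries of
the factors are then simple quotients, each factor is stochastic, and so is their product `P_I`. -/

/-! ### Algebra of semi-infinite matrices -/

/-- Each row has finite support. -/
def RowFinite (A : SMat) : Prop := ∀ n, ∃ N, ∀ k, N ≤ k → A n k = 0

theorem semiMul_apply_of_row {A : SMat} {n N : ℕ} (h : ∀ k, N ≤ k → A n k = 0) (B : SMat) (m : ℕ) :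
    (A ⬝∞ B) n m = ∑ k ∈ Finset.range N, A n k * B k m :=
  tsum_eq_sum fun k hk => by
    rw [h k (by simpa using hk), zero_mul]

theorem semiMul_transpose (A B : SMat) :
    (A ⬝∞ B).transpose = B.transpose ⬝∞ A.transpose := by
  ext n m
  simp only [semiMul, Matrix.transpose_apply, mul_comm]

theorem exists_support_bound {A : SMat} (hA : RowFinite A) (N : ℕ) :
    ∃ M, ∀ n, n < N → ∀ k, M ≤ k → A n k = 0 := by
  choose f hf using hA
  refine ⟨(Finset.range N).sup f, fun n hn k hk => hf n k (le_trans ?_ hk)⟩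
  exact Finset.le_sup (f := f) (Finset.mem_range.2 hn)

theorem RowFinite.semiMul {A B : SMat} (hA : RowFinite A) (hB : RowFinite B) :
    RowFinite (A ⬝∞ B) := by
  intro n
  obtain ⟨N, hN⟩ := hA n
  obtain ⟨M, hM⟩ := exists_support_bound hB N
  refine ⟨M, fun k hk => ?_⟩
  rw [semiMul_apply_of_row hN]
  exact Finset.sum_eq_zero fun i hi => by rw [hM i (Finset.mem_range.1 hi) k hk, mul_zero]

/-- Products defined by infinite series are not associative in general. Here both bracketings reduce
to the same finite double sum over `k < N`, `m < M`. -/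
theorem semiMul_assoc_of_bound {A B C : SMat} {n l N M : ℕ} (hN : ∀ k, N ≤ k → A n k = 0)
    (hM : ∀ k, k < N → ∀ m, M ≤ m → B k m * C m l = 0) :
    (A ⬝∞ B ⬝∞ C) n l = (A ⬝∞ (B ⬝∞ C)) n l := by
  have hBC : ∀ k, k < N → (B ⬝∞ C) k l = ∑ m ∈ Finset.range M, B k m * C m l := fun k hk =>
    tsum_eq_sum fun m hm => hM k hk m (by simpa using hm)
  have hL : (A ⬝∞ B ⬝∞ C) n l = ∑ m ∈ Finset.range M, (A ⬝∞ B) n m * C m l := by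
    refine tsum_eq_sum fun m hm => ?_
    rw [semiMul_apply_of_row hN, Finset.sum_mul]
    refine Finset.sum_eq_zero fun k hk => ?_
    rw [mul_assoc, hM k (Finset.mem_range.1 hk) m (by simpa using hm), mul_zero]
  rw [hL, semiMul_apply_of_row hN]
  simp_rw [semiMul_apply_of_row hN, Finset.sum_mul]
  rw [Finset.sum_comm]
  refine Finset.sum_congr rfl fun k hk => ?_
  rw [hBC k (Finset.mem_range.1 hk), Finset.mul_sum]
  exact Finset.sum_congr rfl fun m _ => mul_assoc _ _ _

theorem semiMul_assoc {A B : SMat} (hA : RowFinite A) (hB : RowFinite B) (C : SMat) :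
    A ⬝∞ B ⬝∞ C = A ⬝∞ (B ⬝∞ C) := by
  ext n l
  obtain ⟨N, hN⟩ := hA n
  obtain ⟨M, hM⟩ := exists_support_bound hB N
  exact semiMul_assoc_of_bound hN fun k hk m hm => by rw [hM k hk m hm, zero_mul]

/-- The column-finite version, needed when the left factor has infinite rows, as `formOneMat` does.
-/
theorem semiMul_assoc_of_transpose (A : SMat) {B C : SMat} (hB : RowFinite B.transpose)
    (hC : RowFinite C.transpose) : A ⬝∞ B ⬝∞ C = A ⬝∞ (B ⬝∞ C) := by
  apply Matrix.transpose_injective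
  simp only [semiMul_transpose]
  rw [semiMul_assoc hC hB]

theorem diagonal_semiMul (D : ℕ → ℝ) (B : SMat) (n m : ℕ) :
    (Matrix.diagonal D ⬝∞ B) n m = D n * B n m := by
  refine (tsum_eq_single n fun k hk => ?_).trans ?_
  · rw [Matrix.diagonal_apply_ne' _ hk, zero_mul]
  · rw [Matrix.diagonal_apply_eq]

theorem one_semiMul (B : SMat) : (1 : SMat) ⬝∞ B = B := by
  ext n m
  rw [← Matrix.diagonal_one, diagonal_semiMul, one_mul]

theorem semiMul_one (B : SMat) : B ⬝∞ (1 : SMat) = B := by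
  apply Matrix.transpose_injective
  rw [semiMul_transpose, Matrix.transpose_one, one_semiMul]

theorem rowFinite_diagonal (D : ℕ → ℝ) : RowFinite (Matrix.diagonal D) := fun n =>
  ⟨n + 1, fun _ hk => Matrix.diagonal_apply_ne _ (by omega)⟩

theorem IsLowerUnitri.rowFinite {S : SMat} (hS : IsLowerUnitri S) : RowFinite S := fun n =>
  ⟨n + 1, fun k hk => hS.2 n k hk⟩

theorem IsLowerUnitri.semiMul_apply {S : SMat} (hS : IsLowerUnitri S) (B : SMat) (n m : ℕ) :
    (S ⬝∞ B) n m = ∑ k ∈ Finset.range (n + 1), S n k * B k m :=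
  semiMul_apply_of_row (fun k hk => hS.2 n k hk) B m

theorem IsLowerUnitri.semiMul {S T : SMat} (hS : IsLowerUnitri S) (hT : IsLowerUnitri T) :
    IsLowerUnitri (S ⬝∞ T) := by
  refine ⟨fun n => ?_, fun n m hnm => ?_⟩
  · rw [hS.semiMul_apply, Finset.sum_range_succ, hS.1, hT.1, Finset.sum_eq_zero]
    · ring
    · exact fun k hk => by rw [hT.2 k n (Finset.mem_range.1 hk), mul_zero]
  · rw [hS.semiMul_apply]
    exact Finset.sum_eq_zero fun k hk => by
      rw [hT.2 k m (by have := Finset.mem_range.1 hk; omega), mul_zero]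

/-! ### Inverses of lower unitriangular matrices -/

/-- A right inverse of a lower unitriangular matrix, by forward substitution. -/
noncomputable def forwardSubst (S : SMat) (m : ℕ) : ℕ → ℝ := fun n =>
  if n < m then 0 else if n = m then 1 else
    -∑ k : Fin n, S n k * forwardSubst S m k
termination_by n => n
decreasing_by exact k.2

theorem exists_right_inverse {S : SMat} (hS : IsLowerUnitri S) :
    ∃ T : SMat, IsLowerUnitri T ∧ S ⬝∞ T = 1 := by
  have hlt : ∀ n m, n < m → forwardSubst S m n = 0 := fun n m h => by
    rw [forwardSubst, if_pos h]
  have hT : IsLowerUnitri (Matrix.of fun n m => forwardSubst S m n) := by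
    refine ⟨fun n => ?_, hlt⟩
    rw [Matrix.of_apply, forwardSubst, if_neg (lt_irrefl _), if_pos rfl]
  refine ⟨_, hT, ?_⟩
  ext n m
  rcases lt_trichotomy n m with h | h | h
  · rw [(hS.semiMul hT).2 n m h, Matrix.one_apply_ne h.ne]
  · subst h
    rw [(hS.semiMul hT).1, Matrix.one_apply_eq]
  · rw [hS.semiMul_apply, Finset.sum_range_succ, hS.1, one_mul, Matrix.of_apply,
      forwardSubst.eq_1 S m n,
      if_neg (by omega), if_neg (by omega), Matrix.one_apply_ne (by omega), Finset.sum_range]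
    exact add_neg_cancel _

/-- Truncation is multiplicative on lower triangular matrices, because rows up to `n` of `S` only
meet indices up to `n`. Hence the truncation of `T` inverts that of `S`. -/
theorem lowerInv_eq_of_semiMul_eq_one {S T : SMat} (hS : IsLowerUnitri S) (hT : IsLowerUnitri T)
    (h : S ⬝∞ T = 1) : lowerInv S = T := by
  ext n m
  rw [lowerInv]
  split_ifs with hmn
  · have key : (Matrix.of fun i j : Fin (n + 1) => S i j)⁻¹ =
        Matrix.of fun i j : Fin (n + 1) => T i j := by
      apply Matrix.inv_eq_right_inv
      ext i j
      have h1 : ∑ k ∈ Finset.range (n + 1), S i k * T k j = (S ⬝∞ T) i j := by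
        symm
        apply semiMul_apply_of_row
        intro k hk
        exact hS.2 _ _ (by have := i.2; omega)
      rw [Matrix.mul_apply]
      simp only [Matrix.of_apply]
      rw [← Finset.sum_range fun k => S i k * T k j, h1, h]
      simp [Matrix.one_apply, Fin.ext_iff]
    rw [key]
    simp
  · exact (hT.2 n m (by omega)).symm

theorem lowerInv_spec {S : SMat} (hS : IsLowerUnitri S) :
    IsLowerUnitri (lowerInv S) ∧ S ⬝∞ lowerInv S = 1 ∧ lowerInv S ⬝∞ S = 1 := by
  obtain ⟨T, hT, hST⟩ := exists_right_inverse hS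
  obtain ⟨W, hW, hTW⟩ := exists_right_inverse hT
  -- A right inverse that has a right inverse itself is two-sided: `S = S (T W) = (S T) W = W`.
  have hSW : S = W := by
    rw [← semiMul_one S, ← hTW, ← semiMul_assoc hS.rowFinite hT.rowFinite, hST, one_semiMul]
  rw [lowerInv_eq_of_semiMul_eq_one hS hT hST]
  exact ⟨hT, hST, hSW ▸ hTW⟩

theorem IsLowerUnitri.lowerInv {S : SMat} (hS : IsLowerUnitri S) :
    IsLowerUnitri (lowerInv S) := (lowerInv_spec hS).1

theorem semiMul_lowerInv {S : SMat} (hS : IsLowerUnitri S) : S ⬝∞ lowerInv S = 1 :=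
  (lowerInv_spec hS).2.1

theorem lowerInv_semiMul {S : SMat} (hS : IsLowerUnitri S) : lowerInv S ⬝∞ S = 1 :=
  (lowerInv_spec hS).2.2

theorem lowerInv_lowerInv {S : SMat} (hS : IsLowerUnitri S) : lowerInv (lowerInv S) = S :=
  lowerInv_eq_of_semiMul_eq_one hS.lowerInv hS (lowerInv_semiMul hS)

/-! ### Uniqueness and existence of Gauss–Borel factorizations -/

/-- The working form `S g = H S̃⁻ᵀ`: it avoids `S⁻¹`, and only needs rows of `S` to be finite,
whatever `g` is. -/
theorem isGaussBorel_iff {g : SMat} {F : BorelData} :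
    IsGaussBorel g F ↔ IsLowerUnitri F.S ∧ IsLowerUnitri F.St ∧ (∀ n, F.H n ≠ 0) ∧
      ∀ n m, (F.S ⬝∞ g) n m = F.H n * lowerInv F.St m n := by
  refine and_congr_right fun hS => and_congr_right fun hSt => and_congr_right fun _ => ?_
  have hcol : RowFinite (lowerInv F.St).transpose.transpose := hSt.lowerInv.rowFinite
  have hd : ∀ n m, (Matrix.diagonal F.H ⬝∞ (lowerInv F.St).transpose) n m =
      F.H n * lowerInv F.St m n := fun n m => diagonal_semiMul _ _ _ _
  rw [semiMul_assoc hS.lowerInv.rowFinite (rowFinite_diagonal _)]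
  constructor
  · intro h n m
    rw [← hd, h, ← semiMul_assoc hS.rowFinite hS.lowerInv.rowFinite, semiMul_lowerInv hS,
      one_semiMul]
  · intro h
    have : F.S ⬝∞ g = Matrix.diagonal F.H ⬝∞ (lowerInv F.St).transpose := by
      ext n m
      rw [h, hd]
    rw [← this, ← semiMul_assoc hS.lowerInv.rowFinite hS.rowFinite, lowerInv_semiMul hS,
      one_semiMul]

/-- A lower unitriangular matrix that maps an upper triangular matrix with nonzero diagonal
to an upper triangular matrix is the identity. -/
theorem eq_one_of_semiMul_upper {M R : SMat} (hM : IsLowerUnitri M)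
    (hR : ∀ n m, m < n → R n m = 0) (hR0 : ∀ n, R n n ≠ 0)
    (hMR : ∀ n m, m < n → (M ⬝∞ R) n m = 0) : M = 1 := by
  ext n m
  rcases lt_trichotomy n m with h | h | h
  · rw [hM.2 n m h, Matrix.one_apply_ne h.ne]
  · subst h
    rw [hM.1, Matrix.one_apply_eq]
  · rw [Matrix.one_apply_ne h.ne']
    -- In the entry `(n, m)` of `M R`, terms with `k < m` vanish by induction and terms with `k > m`
    -- by triangularity of `R`. What is left is `M n m * R m m = 0`.
    induction m using Nat.strong_induction_on with
    | _ m ih =>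
      have h1 := hMR n m h
      rw [hM.semiMul_apply, Finset.sum_eq_single m] at h1
      · exact (mul_eq_zero.1 h1).resolve_right (hR0 m)
      · intro k _ hk
        rcases lt_or_gt_of_ne hk with hk | hk
        · rw [ih k hk (hk.trans h), zero_mul]
        · rw [hR k m hk, mul_zero]
      · intro hm
        exact absurd (Finset.mem_range.2 (by omega)) hm

/-- The quotient of the two left factors is unitriangular and carries one upper triangular matrix to
another, so it is the identity. The diagonal then fixes `H`, and the rest fixes `S̃`. -/
theorem IsGaussBorel.eq {g : SMat} {F G : BorelData} (hF : IsGaussBorel g F)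
    (hG : IsGaussBorel g G) : F = G := by
  obtain ⟨hS, hSt, hH, hg⟩ := isGaussBorel_iff.1 hF
  obtain ⟨hS', hSt', hH', hg'⟩ := isGaussBorel_iff.1 hG
  have hM : G.S ⬝∞ lowerInv F.S ⬝∞ (F.S ⬝∞ g) = G.S ⬝∞ g := by
    rw [semiMul_assoc hS'.rowFinite hS.lowerInv.rowFinite,
      ← semiMul_assoc hS.lowerInv.rowFinite hS.rowFinite, lowerInv_semiMul hS, one_semiMul]
  have h1 : G.S ⬝∞ lowerInv F.S = 1 := by
    refine eq_one_of_semiMul_upper (R := F.S ⬝∞ g) (hS'.semiMul hS.lowerInv) ?_ ?_ ?_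
    · intro n m h
      rw [hg, hSt.lowerInv.2 m n h, mul_zero]
    · intro n
      rw [hg, hSt.lowerInv.1, mul_one]
      exact hH n
    · intro n m h
      rw [hM, hg', hSt'.lowerInv.2 m n h, mul_zero]
  have hSS : F.S = G.S := by
    rw [← one_semiMul F.S, ← h1, semiMul_assoc hS'.rowFinite hS.lowerInv.rowFinite,
      lowerInv_semiMul hS, semiMul_one]
  have hall : ∀ n m, F.H n * lowerInv F.St m n = G.H n * lowerInv G.St m n := fun n m => by
    rw [← hg, ← hg', hSS]
  have hHH : F.H = G.H := by
    ext n
    simpa [hSt.lowerInv.1, hSt'.lowerInv.1] using hall n n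
  have hV : lowerInv F.St = lowerInv G.St := by
    ext m n
    exact mul_left_cancel₀ (hH n) (by rw [hall, hHH])
  have hT : F.St = G.St := by rw [← lowerInv_lowerInv hSt, hV, lowerInv_lowerInv hSt']
  cases F
  cases G
  simp only [BorelData.mk.injEq]
  exact ⟨hSS, hHH, hT⟩

/-- The Gauss–Borel data determined by a lower unitriangular `S` for which `S g` is upper
triangular with nonzero diagonal. -/
noncomputable def borelOfS (g S : SMat) : BorelData where
  S := S
  H := fun n => (S ⬝∞ g) n n
  St := lowerInv fun m n => (S ⬝∞ g) n m / (S ⬝∞ g) n n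

theorem isLowerUnitri_normalized {R : SMat} (hR : ∀ n m, m < n → R n m = 0)
    (hR0 : ∀ n, R n n ≠ 0) : IsLowerUnitri fun m n => R n m / R n n :=
  ⟨fun n => div_self (hR0 n), fun n m h => by simp [hR m n h]⟩

theorem isGaussBorel_borelOfS {g S : SMat} (hS : IsLowerUnitri S)
    (hR : ∀ n m, m < n → (S ⬝∞ g) n m = 0) (hR0 : ∀ n, (S ⬝∞ g) n n ≠ 0) :
    IsGaussBorel g (borelOfS g S) := by
  have hV := isLowerUnitri_normalized hR hR0
  refine isGaussBorel_iff.2 ⟨hS, hV.lowerInv, hR0, fun n m => ?_⟩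
  simp only [borelOfS]
  rw [lowerInv_lowerInv hV]
  field_simp [hR0 n]

theorem IsStochastic.semiMul {A B : SMat} (hA : IsStochastic A) (hB : IsStochastic B)
    (hfin : RowFinite A) : IsStochastic (A ⬝∞ B) := by
  refine ⟨fun n m => tsum_nonneg fun k => mul_nonneg (hA.1 n k) (hB.1 k m), fun n => ?_⟩
  obtain ⟨N, hN⟩ := hfin n
  have h1 : ∑ k ∈ Finset.range N, A n k = 1 :=
    (hasSum_sum_of_ne_finset_zero fun k hk => hN k (by simpa using hk)).unique (hA.2 n)
  simp_rw [semiMul_apply_of_row hN]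
  have := hasSum_sum (s := Finset.range N) fun k _ => (hB.2 k).mul_left (A n k)
  simpa [h1] using this

/-! ### Gauss's summation theorem and the moments of the weights -/

section Moments

open Filter Topology

/-- The rising factorial `x (x + 1) ⋯ (x + n - 1)`. -/
noncomputable def poch (x : ℝ) (n : ℕ) : ℝ := ∏ k ∈ Finset.range n, (x + k)

@[simp] theorem poch_zero (x : ℝ) : poch x 0 = 1 := by simp [poch]

theorem poch_succ (x : ℝ) (n : ℕ) : poch x (n + 1) = poch x n * (x + n) :=
  Finset.prod_range_succ _ _

theorem poch_succ' (x : ℝ) (n : ℕ) : poch x (n + 1) = x * poch (x + 1) n := by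
  rw [poch, Finset.prod_range_succ', poch, mul_comm]
  congr 1
  · simp
  · exact Finset.prod_congr rfl fun k _ => by push_cast; ring

theorem poch_add (x : ℝ) (m n : ℕ) : poch x (m + n) = poch x m * poch (x + m) n := by
  rw [poch, Finset.prod_range_add, poch, poch]
  congr 1
  exact Finset.prod_congr rfl fun k _ => by push_cast; ring

theorem poch_pos {x : ℝ} (hx : 0 < x) (n : ℕ) : 0 < poch x n :=
  Finset.prod_pos fun k _ => by positivity

theorem ascPochhammer_eval_eq_poch (x : ℝ) (n : ℕ) : (ascPochhammer ℝ n).eval x = poch x n := by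
  induction n with
  | zero => simp
  | succ n ih => rw [ascPochhammer_succ_eval, ih, poch_succ]

theorem Gamma_add_nat {x : ℝ} (hx : 0 < x) (n : ℕ) :
    Real.Gamma (x + n) = poch x n * Real.Gamma x := by
  induction n with
  | zero => simp
  | succ n ih =>
    rw [poch_succ, show x + ((n + 1 : ℕ) : ℝ) = (x + n) + 1 by push_cast; ring,
      Real.Gamma_add_one (by positivity), ih]
    ring

/-- The `k`-th term of the hypergeometric series `₂F₁(α, β; γ; 1)`. -/
noncomputable def hypTerm (α β γ : ℝ) (k : ℕ) : ℝ :=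
  poch α k * poch β k / (poch γ k * k.factorial)

theorem hypTerm_succ {α β γ : ℝ} (hγ : 0 < γ) (k : ℕ) :
    hypTerm α β γ (k + 1) = hypTerm α β γ k * ((α + k) * (β + k) / ((γ + k) * (k + 1))) := by
  have h1 := (poch_pos hγ k).ne'
  have h2 : (γ + k) ≠ 0 := by positivity
  have h3 : (k.factorial : ℝ) ≠ 0 := by positivity
  have h4 : (k + 1 : ℝ) ≠ 0 := by positivity
  simp only [hypTerm, poch_succ, Nat.factorial_succ]
  push_cast
  field_simp

/-- This difference serves twice: its sign for large `k` gives convergence, and its vanishing sum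
gives the contiguous relation in `γ`. -/
theorem hypTerm_telescope {α β γ : ℝ} (hγ : 0 < γ) (k : ℕ) :
    k * hypTerm α β γ k - ((k + 1 : ℕ) : ℝ) * hypTerm α β γ (k + 1) =
      hypTerm α β γ k * (((γ - α - β) * k - α * β) / (γ + k)) := by
  have h2 : (γ + k) ≠ 0 := by positivity
  have h4 : (k + 1 : ℝ) ≠ 0 := by positivity
  rw [hypTerm_succ hγ]
  push_cast
  field_simp
  ring

/-- Raabe's test: for large `k` the term is bounded by a constant times the decrease of `k |t_k|`,
so the partial sums telescope to a bounded quantity. -/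
theorem summable_abs_hypTerm {α β γ : ℝ} (hγ : 0 < γ) (h : α + β < γ) :
    Summable fun k => |hypTerm α β γ k| := by
  set s := γ - α - β with hs
  have hs0 : 0 < s := by linarith
  -- Beyond `K` the factors `α + k` and `β + k` are nonnegative and `(s k - α β) / (γ + k) ≥ s / 2`.
  obtain ⟨K, hK⟩ := exists_nat_ge (max (max (-α) (-β)) ((s / 2 * γ + α * β) / (s / 2)))
  have hKα : -α ≤ K := le_trans (le_trans (le_max_left _ _) (le_max_left _ _)) hK
  have hKβ : -β ≤ K := le_trans (le_trans (le_max_right _ _) (le_max_left _ _)) hK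
  have hKs : (s / 2 * γ + α * β) ≤ K * (s / 2) :=
    (div_le_iff₀ (by positivity)).1 (le_trans (le_max_right _ _) hK)
  rw [← summable_nat_add_iff K]
  have step : ∀ k, K ≤ k → s / 2 * |hypTerm α β γ k| ≤
      k * |hypTerm α β γ k| - ((k + 1 : ℕ) : ℝ) * |hypTerm α β γ (k + 1)| := by
    intro k hk
    have hk' : (K : ℝ) ≤ k := by exact_mod_cast hk
    have hr : 0 ≤ (α + k) * (β + k) / ((γ + k) * (k + 1)) := by
      have h1 : 0 ≤ α + k := by linarith
      have h2 : 0 ≤ β + k := by linarith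
      positivity
    have h2 : (0 : ℝ) < γ + k := by positivity
    have h4 : (k + 1 : ℝ) ≠ 0 := by positivity
    rw [hypTerm_succ hγ, abs_mul, abs_of_nonneg hr]
    have e : k * |hypTerm α β γ k| - ((k + 1 : ℕ) : ℝ) *
        (|hypTerm α β γ k| * ((α + k) * (β + k) / ((γ + k) * (k + 1)))) =
        ((s * k - α * β) / (γ + k)) * |hypTerm α β γ k| := by
      rw [hs]
      push_cast
      field_simp
      ring
    rw [e]
    refine mul_le_mul_of_nonneg_right ?_ (abs_nonneg _)
    rw [le_div_iff₀ h2]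
    nlinarith
  refine summable_of_sum_range_le (c := K * |hypTerm α β γ K| / (s / 2))
    (fun _ => abs_nonneg _) fun n => ?_
  rw [le_div_iff₀ (by positivity)]
  have : (∑ i ∈ Finset.range n, |hypTerm α β γ (i + K)|) * (s / 2) ≤
      K * |hypTerm α β γ K| - ((n + K : ℕ) : ℝ) * |hypTerm α β γ (n + K)| := by
    induction n with
    | zero => simp
    | succ n ih =>
      rw [Finset.sum_range_succ, add_mul]
      have := step (n + K) (by omega)
      rw [show n + 1 + K = n + K + 1 by ring]
      linarith
  refine this.trans ?_
  have : 0 ≤ ((n + K : ℕ) : ℝ) * |hypTerm α β γ (n + K)| := by positivity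
  linarith

theorem summable_hypTerm {α β γ : ℝ} (hγ : 0 < γ) (h : α + β < γ) :
    Summable (hypTerm α β γ) := (summable_abs_hypTerm hγ h).of_abs

theorem hypTerm_add_one_right {α β γ : ℝ} (hγ : 0 < γ) (k : ℕ) :
    hypTerm α β (γ + 1) k = hypTerm α β γ k * (γ / (γ + k)) := by
  have h1 := (poch_pos hγ k).ne'
  have h1' := (poch_pos (by linarith : 0 < γ + 1) k).ne'
  have h2 : (γ + k) ≠ 0 := by positivity
  have h3 : (k.factorial : ℝ) ≠ 0 := by positivity
  have h4 : poch γ k * (γ + k) = γ * poch (γ + 1) k := by rw [← poch_succ, poch_succ']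
  simp only [hypTerm]
  rw [div_mul_div_comm, div_eq_div_iff (by positivity) (by positivity)]
  linear_combination (poch α k * poch β k * k.factorial) * h4

/-- A nonzero limit would make the harmonic series converge. With `u k = k t_k` this kills the
boundary term of the telescoping sum without asymptotics of `t_k`. -/
theorem tendsto_zero_of_summable_div {u : ℕ → ℝ} {L : ℝ} (hu : Tendsto u atTop (𝓝 L))
    (hs : Summable fun k : ℕ => |u k| / k) : L = 0 := by
  by_contra hL
  have hL' : 0 < |L| := abs_pos.2 hL
  have hev : ∀ᶠ k : ℕ in atTop, |L| / 2 < |u k| :=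
    hu.abs.eventually (lt_mem_nhds (half_lt_self hL'))
  refine Real.not_summable_one_div_natCast ?_
  refine Summable.of_norm_bounded_eventually_nat (hs.mul_left (2 / |L|)) ?_
  filter_upwards [hev] with k hk
  rw [Real.norm_of_nonneg (by positivity), div_mul_div_comm, ← div_div]
  refine div_le_div_of_nonneg_right ?_ (by positivity)
  rw [le_div_iff₀ hL']
  linarith

theorem hasSum_hypTerm_telescope {α β γ : ℝ} (hγ : 0 < γ) (h : α + β < γ) :
    HasSum (fun k : ℕ => hypTerm α β γ k * (((γ - α - β) * k - α * β) / (γ + k))) 0 := by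
  have e : (fun k : ℕ => hypTerm α β γ k * (((γ - α - β) * k - α * β) / (γ + k))) = fun k =>
      (γ - α - β) * hypTerm α β γ k - ((γ - α) * (γ - β) / γ) * hypTerm α β (γ + 1) k := by
    ext k
    have h2 : (γ + k) ≠ 0 := by positivity
    rw [hypTerm_add_one_right hγ]
    field_simp
    ring
  have hsum : Summable fun k : ℕ =>
      hypTerm α β γ k * (((γ - α - β) * k - α * β) / (γ + k)) := by
    rw [e]
    exact ((summable_hypTerm hγ h).mul_left _).sub
      ((summable_hypTerm (by linarith) (by linarith)).mul_left _)
  obtain ⟨L, hL⟩ := hsum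
  have h1 := hL.tendsto_sum_nat
  have h2 : ∀ n, ∑ k ∈ Finset.range n, hypTerm α β γ k *
      (((γ - α - β) * k - α * β) / (γ + k)) = -(n * hypTerm α β γ n) := by
    intro n
    rw [← Finset.sum_congr rfl fun k _ => hypTerm_telescope hγ k,
      Finset.sum_range_sub' fun k : ℕ => (k : ℝ) * hypTerm α β γ k]
    simp
  simp_rw [h2] at h1
  have h3 : L = 0 := by
    refine tendsto_zero_of_summable_div h1 ?_
    refine (summable_abs_hypTerm hγ h).of_nonneg_of_le (fun k => by positivity) fun k => ?_
    rw [abs_neg, abs_mul, Nat.abs_cast]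
    rcases Nat.eq_zero_or_pos k with rfl | hk
    · simp
    · rw [mul_div_cancel_left₀ _ (by positivity)]
  rwa [h3] at hL

theorem tsum_hypTerm_contiguous {α β γ : ℝ} (hγ : 0 < γ) (h : α + β < γ) :
    (γ - α - β) * ∑' k, hypTerm α β γ k =
      ((γ - α) * (γ - β) / γ) * ∑' k, hypTerm α β (γ + 1) k := by
  have h0 := (hasSum_hypTerm_telescope hγ h).tsum_eq
  have e : (fun k : ℕ => hypTerm α β γ k * (((γ - α - β) * k - α * β) / (γ + k))) = fun k =>
      (γ - α - β) * hypTerm α β γ k - ((γ - α) * (γ - β) / γ) * hypTerm α β (γ + 1) k := by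
    ext k
    have h2 : (γ + k) ≠ 0 := by positivity
    rw [hypTerm_add_one_right hγ]
    field_simp
    ring
  rw [e, ((summable_hypTerm hγ h).mul_left _).tsum_sub
      ((summable_hypTerm (by linarith) (by linarith)).mul_left _), tsum_mul_left,
      tsum_mul_left] at h0
  linarith

theorem poch_mono {x y : ℝ} (hx : 0 < x) (h : x ≤ y) (k : ℕ) : poch x k ≤ poch y k :=
  Finset.prod_le_prod (fun i _ => by positivity) fun i _ => by linarith

theorem tendsto_poch_succ_atTop (x : ℝ) (k : ℕ) :
    Tendsto (fun N : ℕ => poch (x + N) (k + 1)) atTop atTop := by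
  have hlin : ∀ k : ℕ, Tendsto (fun N : ℕ => x + N + k) atTop atTop := fun k =>
    tendsto_atTop_add_const_right _ _
      (tendsto_atTop_add_const_left _ _ tendsto_natCast_atTop_atTop)
  induction k with
  | zero => simpa [poch] using hlin 0
  | succ k ih =>
    simp_rw [poch_succ _ (k + 1)]
    exact ih.atTop_mul_atTop₀ (hlin (k + 1))

/-- Every term but the first tends to zero, and increasing `γ` only decreases absolute values, so
the series at `γ` dominates. -/
theorem tendsto_tsum_hypTerm {α β γ : ℝ} (hγ : 0 < γ) (h : α + β < γ) :
    Tendsto (fun N : ℕ => ∑' k, hypTerm α β (γ + N) k) atTop (𝓝 1) := by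
  have h1 : (1 : ℝ) = ∑' k : ℕ, if k = 0 then (1 : ℝ) else 0 := by simp
  rw [h1]
  refine tendsto_tsum_of_dominated_convergence (summable_abs_hypTerm hγ h) ?_ ?_
  · rintro (_ | k)
    · simp [hypTerm]
    · simp only [hypTerm, Nat.add_eq_zero_iff, one_ne_zero, and_false, if_false]
      refine Tendsto.div_atTop tendsto_const_nhds ?_
      exact (tendsto_poch_succ_atTop γ k).atTop_mul_const (by positivity)
  · refine Eventually.of_forall fun N k => ?_
    have hp := poch_pos hγ k
    have hm := poch_mono hγ (by simp : γ ≤ γ + N) k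
    have hq := poch_pos (by positivity : 0 < γ + N) k
    simp only [hypTerm, Real.norm_eq_abs, abs_div]
    refine div_le_div_of_nonneg_left (abs_nonneg _) ?_ ?_
    · positivity
    · rw [abs_of_pos (by positivity), abs_of_nonneg (by positivity)]
      gcongr

theorem GammaSeq_eq_poch (x : ℝ) (n : ℕ) :
    Real.GammaSeq x n = (n : ℝ) ^ x * n.factorial / poch x (n + 1) := rfl

/-- Gauss's summation theorem. -/
theorem tsum_hypTerm {α β γ : ℝ} (hγ : 0 < γ) (h : α + β < γ) (hα : α < γ) (hβ : β < γ) :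
    ∑' k, hypTerm α β γ k = Real.Gamma γ * Real.Gamma (γ - α - β) /
      (Real.Gamma (γ - α) * Real.Gamma (γ - β)) := by
  have hs : 0 < γ - α - β := by linarith
  have hα' : 0 < γ - α := by linarith
  have hβ' : 0 < γ - β := by linarith
  -- Iterating the contiguous relation pushes `γ` to infinity, where the sum tends to `1`. The
  -- prefactor tends to the quotient of Gamma values by Euler's limit formula.
  have hF : ∀ N : ℕ, ∑' k, hypTerm α β γ k = poch (γ - α) N * poch (γ - β) N /
      (poch γ N * poch (γ - α - β) N) * ∑' k, hypTerm α β (γ + N) k := by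
    intro N
    induction N with
    | zero => simp
    | succ N ih =>
      have hN : 0 < γ + N := by positivity
      have hc := tsum_hypTerm_contiguous (α := α) (β := β) hN (by linarith [hN])
      have h1 := (poch_pos hγ N).ne'
      have h2 := (poch_pos hs N).ne'
      have h3 : γ - α - β + N ≠ 0 := (add_pos_of_pos_of_nonneg hs N.cast_nonneg).ne'
      rw [ih]
      simp only [poch_succ]
      rw [show γ + ((N + 1 : ℕ) : ℝ) = γ + N + 1 by push_cast; ring]
      have hc' : ∑' k, hypTerm α β (γ + N) k = ((γ - α + N) * (γ - β + N) /
          ((γ + N) * (γ - α - β + N))) * ∑' k, hypTerm α β (γ + N + 1) k := by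
        rw [show γ + N - α - β = γ - α - β + N by ring, show γ + N - α = γ - α + N by ring,
          show γ + N - β = γ - β + N by ring] at hc
        rw [mul_comm (γ + N), ← div_div, div_right_comm, div_mul_eq_mul_div, ← hc,
          mul_div_cancel_left₀ _ h3]
      rw [hc', ← mul_assoc, div_mul_div_comm]
      congr 2 <;> ring
  have hG : Tendsto (fun n : ℕ => Real.GammaSeq γ n * Real.GammaSeq (γ - α - β) n /
      (Real.GammaSeq (γ - α) n * Real.GammaSeq (γ - β) n)) atTop
      (𝓝 (Real.Gamma γ * Real.Gamma (γ - α - β) /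
        (Real.Gamma (γ - α) * Real.Gamma (γ - β)))) :=
    ((Real.GammaSeq_tendsto_Gamma _).mul (Real.GammaSeq_tendsto_Gamma _)).div
      ((Real.GammaSeq_tendsto_Gamma _).mul (Real.GammaSeq_tendsto_Gamma _))
      (mul_pos (Real.Gamma_pos_of_pos hα') (Real.Gamma_pos_of_pos hβ')).ne'
  -- `GammaSeq x n` contains a rising factorial with `n + 1` factors, so the iteration is read at `N
  -- = n + 1`.
  have hT := (tendsto_tsum_hypTerm hγ h).comp (tendsto_add_atTop_nat 1)
  have hGT := hG.mul hT
  rw [mul_one] at hGT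
  refine tendsto_nhds_unique (Tendsto.congr' ?_ tendsto_const_nhds) hGT
  filter_upwards [eventually_gt_atTop 0] with n hn
  have hn' : (0 : ℝ) < n := by exact_mod_cast hn
  rw [hF (n + 1)]
  simp only [Function.comp]
  congr 1
  simp only [GammaSeq_eq_poch]
  -- The powers of `n` in Euler's formula cancel because both pairs of exponents have the same sum.
  have hp : (n : ℝ) ^ γ * (n : ℝ) ^ (γ - α - β) = (n : ℝ) ^ (γ - α) * (n : ℝ) ^ (γ - β) := by
    rw [← Real.rpow_add hn', ← Real.rpow_add hn']
    congr 1
    ring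
  have h1 := (poch_pos hγ (n + 1)).ne'
  have h2 := (poch_pos hs (n + 1)).ne'
  have h3 := (poch_pos hα' (n + 1)).ne'
  have h4 := (poch_pos hβ' (n + 1)).ne'
  have h5 := (Real.rpow_pos_of_pos hn' (γ - α)).ne'
  have h6 := (Real.rpow_pos_of_pos hn' (γ - β)).ne'
  have h7 : (n.factorial : ℝ) ≠ 0 := by positivity
  have h8 := (Real.rpow_pos_of_pos hn' γ).ne'
  have h9 := (Real.rpow_pos_of_pos hn' (γ - α - β)).ne'
  rw [div_mul_div_comm, div_mul_div_comm, div_div_div_eq, div_eq_div_iff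
    (mul_ne_zero h1 h2) (mul_ne_zero (mul_ne_zero h1 h2)
      (mul_ne_zero (mul_ne_zero h5 h7) (mul_ne_zero h6 h7)))]
  linear_combination (-(poch (γ - α) (n + 1) * poch (γ - β) (n + 1) * (n.factorial) ^ 2 *
    (poch γ (n + 1) * poch (γ - α - β) (n + 1)))) * hp

/-! ### Beta integrals and termwise integration -/

/-- This is the normalization of the Beta probability distribution. -/
theorem integral_beta {s t : ℝ} (hs : 0 < s) (ht : 0 < t) :
    ∫ x in Set.Ioo (0 : ℝ) 1, x ^ (s - 1) * (1 - x) ^ (t - 1) =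
      Real.Gamma s * Real.Gamma t / Real.Gamma (s + t) := by
  have hB := ProbabilityTheory.beta_pos hs ht
  have h1 : ∫ x in Set.Ioo (0 : ℝ) 1, 1 / ProbabilityTheory.beta s t * x ^ (s - 1) *
      (1 - x) ^ (t - 1) = 1 := by
    rw [integral_eq_lintegral_of_nonneg_ae, ← ProbabilityTheory.lintegral_betaPDF,
      ProbabilityTheory.lintegral_betaPDF_eq_one hs ht, ENNReal.toReal_one]
    · filter_upwards [ae_restrict_mem measurableSet_Ioo] with x hx
      have h1 : 0 < x := hx.1
      have h2 : 0 < 1 - x := by linarith [hx.2]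
      simp only [Pi.zero_apply]
      positivity
    · exact Measurable.aestronglyMeasurable (by fun_prop)
  simp_rw [mul_assoc] at h1
  rw [integral_const_mul, one_div, inv_mul_eq_one₀ hB.ne'] at h1
  exact h1.symm

/-- A non-integrable function has integral `0` by convention, whereas the value just found is
positive. -/
theorem integrable_beta {s t : ℝ} (hs : 0 < s) (ht : 0 < t) :
    IntegrableOn (fun x : ℝ => x ^ (s - 1) * (1 - x) ^ (t - 1)) (Set.Ioo (0 : ℝ) 1) := by
  by_contra h
  have h0 := integral_undef h
  rw [integral_beta hs ht] at h0
  exact (ProbabilityTheory.beta_pos hs ht).ne' h0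

/-- Each Beta integral replaces `(δ)_k` by `(s + δ)_k` in the denominator of the term, so the
integral becomes a `₂F₁` at `1` with lower parameter `s + δ`. Its absolute convergence also
justifies the exchange of sum and integral. -/
theorem integral_hypergeometric {α β s δ : ℝ} (hs : 0 < s) (hδ : 0 < δ) (h : α + β < s + δ)
    (hα : α < s + δ) (hβ : β < s + δ) :
    ∫ x in Set.Ioo (0 : ℝ) 1, x ^ (s - 1) * (1 - x) ^ (δ - 1) *
        ordinaryHypergeometric α β δ (1 - x) =
      Real.Gamma s * Real.Gamma δ * Real.Gamma (s + δ - α - β) /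
        (Real.Gamma (s + δ - α) * Real.Gamma (s + δ - β)) := by
  have hsδ : 0 < s + δ := by linarith
  set F : ℕ → ℝ → ℝ := fun k x =>
    hypTerm α β δ k * (x ^ (s - 1) * (1 - x) ^ (δ + k - 1)) with hF
  have hpos : ∀ k : ℕ, 0 < δ + k := fun k => by positivity
  have hint : ∀ k, IntegrableOn (F k) (Set.Ioo (0 : ℝ) 1) := fun k =>
    (integrable_beta hs (hpos k)).const_mul _
  have hcoef : ∀ k : ℕ, Real.Gamma s * Real.Gamma (δ + k) / Real.Gamma (s + (δ + k)) =
      Real.Gamma s * Real.Gamma δ / Real.Gamma (s + δ) * (poch δ k / poch (s + δ) k) := by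
    intro k
    rw [← add_assoc, Gamma_add_nat hδ, Gamma_add_nat hsδ, div_mul_div_comm]
    congr 1 <;> ring
  have hterm : ∀ k, hypTerm α β δ k * (poch δ k / poch (s + δ) k) = hypTerm α β (s + δ) k := by
    intro k
    have h1 := (poch_pos hδ k).ne'
    simp only [hypTerm]
    rw [div_mul_div_comm, div_eq_div_iff]
    · ring
    all_goals
      have := poch_pos hδ k
      have := poch_pos hsδ k
      positivity
  have hval : ∀ k, ∫ x in Set.Ioo (0 : ℝ) 1, F k x =
      Real.Gamma s * Real.Gamma δ / Real.Gamma (s + δ) * hypTerm α β (s + δ) k := by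
    intro k
    rw [hF, integral_const_mul, integral_beta hs (hpos k), hcoef, ← hterm]
    ring
  have hnorm : ∀ k, ∫ x in Set.Ioo (0 : ℝ) 1, ‖F k x‖ =
      Real.Gamma s * Real.Gamma δ / Real.Gamma (s + δ) * |hypTerm α β (s + δ) k| := by
    intro k
    have : ∫ x in Set.Ioo (0 : ℝ) 1, ‖F k x‖ = ∫ x in Set.Ioo (0 : ℝ) 1,
        |hypTerm α β δ k| * (x ^ (s - 1) * (1 - x) ^ (δ + k - 1)) := by
      refine setIntegral_congr_fun measurableSet_Ioo fun x hx => ?_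
      have h1 : 0 < x := hx.1
      have h2 : 0 < 1 - x := by linarith [hx.2]
      simp only [hF]
      rw [norm_mul, Real.norm_eq_abs, Real.norm_of_nonneg (by positivity)]
    have hq : 0 < poch δ k / poch (s + δ) k := div_pos (poch_pos hδ k) (poch_pos hsδ k)
    rw [this, integral_const_mul, integral_beta hs (hpos k), hcoef, ← hterm, abs_mul,
      abs_of_pos hq]
    ring
  have hsumm : Summable fun k => ∫ x in Set.Ioo (0 : ℝ) 1, ‖F k x‖ := by
    simp_rw [hnorm]
    exact (summable_abs_hypTerm hsδ h).mul_left _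
  have hS := hasSum_integral_of_summable_integral_norm hint hsumm
  have hfun : ∫ x in Set.Ioo (0 : ℝ) 1, x ^ (s - 1) * (1 - x) ^ (δ - 1) *
        ordinaryHypergeometric α β δ (1 - x) = ∫ x in Set.Ioo (0 : ℝ) 1, ∑' k, F k x := by
    refine setIntegral_congr_fun measurableSet_Ioo fun x hx => ?_
    have h2 : 0 < 1 - x := by linarith [hx.2]
    simp only [ordinaryHypergeometric_eq_tsum]
    rw [← tsum_mul_left]
    refine tsum_congr fun k => ?_
    simp only [hF, hypTerm, ascPochhammer_eval_eq_poch, smul_eq_mul]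
    rw [show δ + k - 1 = (δ - 1) + k by ring, Real.rpow_add_natCast h2.ne']
    have h1 := (poch_pos hδ k).ne'
    have h3 : (k.factorial : ℝ) ≠ 0 := by positivity
    field_simp
  have hΓ := (Real.Gamma_pos_of_pos hsδ).ne'
  rw [hfun, ← hS.tsum_eq]
  simp_rw [hval]
  rw [tsum_mul_left, tsum_hypTerm hsδ h hα hβ]
  field_simp

theorem integral_mu {a b c d : ℝ} (ha : 0 < a) (hb : 0 < b) (hc : 0 < c) (hd : 0 < d)
    (hδ : 0 < c + d - a - b) (f : ℝ → ℝ) (i : ℕ) :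
    ∫ x, x ^ i * f x ∂(mu a b c d) =
      Real.Gamma c * Real.Gamma d / (Real.Gamma a * Real.Gamma b * Real.Gamma (c + d - a - b)) *
      ∫ x in Set.Ioo (0 : ℝ) 1, x ^ (a + i - 1) * (1 - x) ^ (c + d - a - b - 1) * f x := by
  have hmeas : Measurable fun x => ENNReal.ofReal (density a b c d x) := by
    unfold density
    fun_prop
  rw [mu, integral_withDensity_eq_integral_toReal_smul hmeas
    (Eventually.of_forall fun x => ENNReal.ofReal_lt_top), ← integral_const_mul]
  refine setIntegral_congr_fun measurableSet_Ioo fun x hx => ?_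
  have h1 : 0 < x := hx.1
  have h2 : 0 < 1 - x := by linarith [hx.2]
  have := Real.Gamma_pos_of_pos ha
  have := Real.Gamma_pos_of_pos hb
  have := Real.Gamma_pos_of_pos hc
  have := Real.Gamma_pos_of_pos hd
  have := Real.Gamma_pos_of_pos hδ
  have hden : 0 ≤ density a b c d x := by
    unfold density
    positivity
  simp only [smul_eq_mul]
  rw [ENNReal.toReal_ofReal hden, density, show a + i - 1 = (a - 1) + i by ring,
    Real.rpow_add_natCast h1.ne']
  ring

/-- The moment of order `k` of the weight with parameters `(a, b; c, d)`. -/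
noncomputable def mom (a b c d : ℝ) (k : ℕ) : ℝ :=
  poch a k * poch b k / (poch c k * poch d k)

theorem integral_w₁ {a b c d : ℝ} (ha : 0 < a) (hb : 0 < b) (hc : 0 < c) (hd : 0 < d)
    (hδ : 0 < c + d - a - b) (k : ℕ) :
    ∫ x, x ^ k * w₁ a b c d x ∂(mu a b c d) = mom a b c d k := by
  rw [integral_mu ha hb hc hd hδ]
  simp only [w₁]
  have e1 : a + k + (c + d - a - b) - (c - b) - (d - b) = b + k := by ring
  have e2 : a + k + (c + d - a - b) - (c - b) = d + k := by ring
  have e3 : a + k + (c + d - a - b) - (d - b) = c + k := by ring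
  have hk : (0 : ℝ) ≤ k := Nat.cast_nonneg k
  rw [integral_hypergeometric (by positivity) hδ (by linarith) (by linarith) (by linarith),
    e1, e2, e3, Gamma_add_nat ha, Gamma_add_nat hb, Gamma_add_nat hc, Gamma_add_nat hd, mom]
  have := (Real.Gamma_pos_of_pos ha).ne'
  have := (Real.Gamma_pos_of_pos hb).ne'
  have := (Real.Gamma_pos_of_pos hc).ne'
  have := (Real.Gamma_pos_of_pos hd).ne'
  have := (Real.Gamma_pos_of_pos hδ).ne'
  have := (poch_pos hc k).ne'
  have := (poch_pos hd k).ne'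
  field_simp

/-- Raising `b` and `c` together leaves `δ` and `c - b` unchanged, and the factor `c / b` adapts the
Gamma constants: `w₂` is the first weight for the raised parameters. -/
theorem integral_w₂ {a b c d : ℝ} (ha : 0 < a) (hb : 0 < b) (hc : 0 < c) (hd : 0 < d)
    (hδ : 0 < c + d - a - b) (k : ℕ) :
    ∫ x, x ^ k * w₂ a b c d x ∂(mu a b c d) = mom a (b + 1) (c + 1) d k := by
  rw [integral_mu ha hb hc hd hδ]
  simp only [w₂]
  simp_rw [mul_left_comm _ (c / b)]
  rw [integral_const_mul]
  have e1 : a + k + (c + d - a - b) - (c - b) - (d - b - 1) = (b + 1) + k := by ring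
  have e2 : a + k + (c + d - a - b) - (c - b) = d + k := by ring
  have e3 : a + k + (c + d - a - b) - (d - b - 1) = (c + 1) + k := by ring
  have hk : (0 : ℝ) ≤ k := Nat.cast_nonneg k
  have hb1 : 0 < b + 1 := by linarith
  have hc1 : 0 < c + 1 := by linarith
  rw [integral_hypergeometric (by positivity) hδ (by linarith) (by linarith) (by linarith),
    e1, e2, e3, Gamma_add_nat ha, Gamma_add_nat hb1, Gamma_add_nat hc1, Gamma_add_nat hd, mom,
    Real.Gamma_add_one hb.ne', Real.Gamma_add_one hc.ne']
  have := (Real.Gamma_pos_of_pos ha).ne'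
  have := (Real.Gamma_pos_of_pos hb).ne'
  have := (Real.Gamma_pos_of_pos hc).ne'
  have := (Real.Gamma_pos_of_pos hd).ne'
  have := (Real.Gamma_pos_of_pos hδ).ne'
  have := (poch_pos hc1 k).ne'
  have := (poch_pos hd k).ne'
  field_simp

theorem momentMatrix_even {a b c d : ℝ} (ha : 0 < a) (hb : 0 < b) (hc : 0 < c) (hd : 0 < d)
    (hδ : 0 < c + d - a - b) (i k : ℕ) :
    momentMatrix a b c d i (2 * k) = mom a b c d (i + k) := by
  rw [← integral_w₁ ha hb hc hd hδ]
  simp only [momentMatrix, xi, X₁, X₂]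
  simp [pow_add, mul_assoc]

theorem momentMatrix_odd {a b c d : ℝ} (ha : 0 < a) (hb : 0 < b) (hc : 0 < c) (hd : 0 < d)
    (hδ : 0 < c + d - a - b) (i k : ℕ) :
    momentMatrix a b c d i (2 * k + 1) = mom a (b + 1) (c + 1) d (i + k) := by
  rw [← integral_w₂ ha hb hc hd hδ]
  simp only [momentMatrix, xi, X₁, X₂]
  have h1 : (2 * k + 1) % 2 = 1 := by omega
  have h2 : (2 * k + 1) / 2 = k := by omega
  simp [pow_add, mul_assoc, h1, h2]

theorem w₁_one (a b c d : ℝ) : w₁ a b c d 1 = 1 := by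
  simp [w₁, ordinaryHypergeometric_zero]

theorem w₂_one (a b c d : ℝ) : w₂ a b c d 1 = c / b := by
  simp [w₂, ordinaryHypergeometric_zero]

end Moments

/-! ### Type II polynomials -/

/-- The coefficient of `x ^ i` in the monic polynomial proportional to
`₃F₂(-n, e, f; a, b; x)`. -/
noncomputable def mopCoef (a b e f : ℝ) (n i : ℕ) : ℝ :=
  (-1) ^ (n + i) * n.choose i * (poch a n / poch a i) * (poch b n / poch b i) *
    (poch e i / poch e n) * (poch f i / poch f n)

theorem mopCoef_swap (a b e f : ℝ) (n i : ℕ) : mopCoef a b e f n i = mopCoef b a f e n i := by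
  simp only [mopCoef]
  ring

theorem mopCoef_swap_right (a b e f : ℝ) (n i : ℕ) :
    mopCoef a b e f n i = mopCoef a b f e n i := by
  simp only [mopCoef]
  ring

theorem mopCoef_of_lt (a b e f : ℝ) {n i : ℕ} (h : n < i) : mopCoef a b e f n i = 0 := by
  simp [mopCoef, Nat.choose_eq_zero_of_lt h]

theorem mopCoef_self {a b e f : ℝ} {n : ℕ} (ha : 0 < a) (hb : 0 < b) (he : poch e n ≠ 0)
    (hf : poch f n ≠ 0) : mopCoef a b e f n n = 1 := by
  have h1 := (poch_pos ha n).ne'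
  have h2 := (poch_pos hb n).ne'
  simp [mopCoef, h1, h2, he, hf, ← two_mul]

theorem poch_add_one {x : ℝ} (hx : x ≠ 0) (n : ℕ) : poch (x + 1) n = poch x n * (x + n) / x := by
  rw [← poch_succ, poch_succ', mul_div_cancel_left₀ _ hx]

theorem choose_succ_mul_cast (m i : ℕ) :
    ((m + 1).choose i : ℝ) * (m + 1 - i) = (m + 1) * m.choose i := by
  rcases le_or_gt i (m + 1) with h | h
  · have := Nat.choose_mul_succ_eq m i
    have h2 : (m.choose i : ℝ) * ((m + 1 : ℕ) : ℝ) =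
        (m + 1).choose i * ((m + 1 - i : ℕ) : ℝ) := by exact_mod_cast this
    rw [Nat.cast_sub h] at h2
    push_cast at h2
    linarith
  · rw [Nat.choose_eq_zero_of_lt h, Nat.choose_eq_zero_of_lt (by omega)]
    simp

theorem choose_succ_right_cast (n i : ℕ) :
    (n.choose (i + 1) : ℝ) * (i + 1) = n.choose i * (n - i) := by
  rcases le_or_gt i n with h | h
  · have h2 : (n.choose (i + 1) : ℝ) * ((i + 1 : ℕ) : ℝ) =
        n.choose i * ((n - i : ℕ) : ℝ) := by exact_mod_cast Nat.choose_succ_right_eq n i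
    rw [Nat.cast_sub h] at h2
    push_cast at h2
    exact h2
  · rw [Nat.choose_eq_zero_of_lt h, Nat.choose_eq_zero_of_lt (by omega)]
    simp

/-- Raising one lower and one upper parameter of the `₃F₂` costs a single lower-degree term. By the
symmetries of `mopCoef` this one relation yields both `L₁` and `L₂`. -/
theorem mopCoef_contiguous {a b e f : ℝ} (ha : 0 < a) (hb : 0 < b) (he : 0 < e) (hf : 0 < f)
    (m i : ℕ) :
    mopCoef a b e f (m + 1) i = mopCoef (a + 1) b e (f + 1) (m + 1) i +
      (m + 1) * (b + m) * (f - a) / ((f + m) * (f + m + 1) * (e + m)) *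
        mopCoef (a + 1) b e f m i := by
  -- Written this way round, the relation between binomials also holds for `i = m + 1`, so no
  -- boundary case is split off.
  have hc : (m.choose i : ℝ) = (m + 1).choose i * (m + 1 - i) / (m + 1) := by
    rw [choose_succ_mul_cast, mul_div_cancel_left₀ _ (by positivity)]
  simp only [mopCoef, poch_add_one ha.ne', poch_add_one hf.ne', poch_succ]
  rw [hc, show m + 1 + i = m + i + 1 by ring, pow_succ]
  have h1 := (poch_pos ha m).ne'
  have h2 := (poch_pos hb m).ne'
  have h3 := (poch_pos he m).ne'
  have h4 := (poch_pos hf m).ne'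
  have h5 := (poch_pos ha i).ne'
  have h6 := (poch_pos hb i).ne'
  have h7 : a + i ≠ 0 := by positivity
  have h8 : a + m ≠ 0 := by positivity
  have h9 : b + m ≠ 0 := by positivity
  have h10 : e + m ≠ 0 := by positivity
  have h11 : f + m ≠ 0 := by positivity
  have h12 : f + m + 1 ≠ 0 := by positivity
  have h13 : (m + 1 : ℝ) ≠ 0 := by positivity
  have h14 : f + (m + 1) ≠ 0 := by positivity
  push_cast
  generalize (-1 : ℝ) ^ (m + i) = s
  generalize ((m + 1).choose i : ℝ) = t
  generalize poch a m = am at *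
  generalize poch b m = bm at *
  generalize poch e m = em at *
  generalize poch f m = fm at *
  generalize poch a i = ai at *
  generalize poch b i = bi at *
  generalize poch e i = ei at *
  generalize poch f i = fi at *
  field_simp
  ring

/-- The relation behind `U`, for the coefficient of `x ^ (i + 1)`: the right side belongs to `x`
times the polynomial with all parameters raised. `mopCoef_zero_right` is its constant coefficient.
-/
theorem mopCoef_shift {a b e f : ℝ} (ha : 0 < a) (hb : 0 < b) (he : 0 < e) (hf : 0 < f)
    (n i : ℕ) :
    (a + n) * (b + n) * f / ((f + n) * (f + n + 1) * (e + n)) * mopCoef a b e f n (i + 1) +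
      mopCoef a b (f + 1) e (n + 1) (i + 1) = mopCoef (a + 1) (b + 1) (e + 1) (f + 1) n i := by
  have hc1 : (n.choose (i + 1) : ℝ) = n.choose i * (n - i) / (i + 1) := by
    rw [← choose_succ_right_cast, mul_div_cancel_right₀ _ (by positivity)]
  have hc2 : ((n + 1).choose (i + 1) : ℝ) = n.choose i * (n + 1) / (i + 1) := by
    rw [Nat.choose_succ_succ, Nat.cast_add, hc1]
    field_simp
    ring
  simp only [mopCoef, poch_add_one ha.ne', poch_add_one hb.ne', poch_add_one he.ne',
    poch_add_one hf.ne', poch_succ]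
  rw [hc1, hc2, show n + 1 + (i + 1) = n + i + 2 by ring, ← add_assoc, pow_succ, pow_add]
  have h1 := (poch_pos ha n).ne'
  have h2 := (poch_pos hb n).ne'
  have h3 := (poch_pos he n).ne'
  have h4 := (poch_pos hf n).ne'
  have h5 := (poch_pos ha i).ne'
  have h6 := (poch_pos hb i).ne'
  have h7 : a + i ≠ 0 := by positivity
  have h7' : b + i ≠ 0 := by positivity
  have h8 : a + n ≠ 0 := by positivity
  have h9 : b + n ≠ 0 := by positivity
  have h10 : e + n ≠ 0 := by positivity
  have h11 : f + n ≠ 0 := by positivity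
  have h12 : f + n + 1 ≠ 0 := by positivity
  have h13 : (i + 1 : ℝ) ≠ 0 := by positivity
  have h14 : f + (n + 1) ≠ 0 := by positivity
  have h15 : f + 1 + n ≠ 0 := by positivity
  push_cast
  generalize (-1 : ℝ) ^ (n + i) = s
  generalize (n.choose i : ℝ) = t
  generalize poch a n = am at *
  generalize poch b n = bm at *
  generalize poch e n = em at *
  generalize poch f n = fm at *
  generalize poch a i = ai at *
  generalize poch b i = bi at *
  generalize poch e i = ei at *
  generalize poch f i = fi at *
  field_simp
  ring

theorem mopCoef_zero_right {a b e f : ℝ} (ha : 0 < a) (hb : 0 < b) (he : 0 < e) (hf : 0 < f)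
    (n : ℕ) :
    (a + n) * (b + n) * f / ((f + n) * (f + n + 1) * (e + n)) * mopCoef a b e f n 0 +
      mopCoef a b (f + 1) e (n + 1) 0 = 0 := by
  simp only [mopCoef, poch_add_one hf.ne', poch_succ, poch_zero]
  have h1 := (poch_pos ha n).ne'
  have h2 := (poch_pos hb n).ne'
  have h3 := (poch_pos he n).ne'
  have h4 := (poch_pos hf n).ne'
  have h10 : e + n ≠ 0 := by positivity
  have h11 : f + n ≠ 0 := by positivity
  have h12 : f + n + 1 ≠ 0 := by positivity
  have h15 : f + 1 + n ≠ 0 := by positivity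
  rw [add_zero, add_zero, pow_succ]
  push_cast
  simp only [Nat.choose_zero_right, Nat.cast_one, add_zero]
  generalize poch a n = am at *
  generalize poch b n = bm at *
  generalize poch e n = em at *
  generalize poch f n = fm at *
  field_simp
  ring

/-! ### Alternating binomial sums -/

open Polynomial in
-- The sum is the `n`-th forward difference of `P` at `0`.
theorem sum_alternating_choose_eval {P : ℝ[X]} {n : ℕ} (hP : P.natDegree < n) :
    ∑ i ∈ Finset.range (n + 1), (-1 : ℝ) ^ (n + i) * n.choose i * P.eval (i : ℝ) = 0 := by
  have h := congrFun (Polynomial.fwdDiff_iter_eq_zero_of_degree_lt hP) 0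
  rw [fwdDiff_iter_eq_sum_shift] at h
  rw [Pi.zero_apply] at h
  rw [← h]
  refine Finset.sum_congr rfl fun i hi => ?_
  have hi' : i ≤ n := by simpa [Nat.lt_succ_iff] using hi
  rw [show n + i = (n - i) + 2 * i by omega, pow_add, pow_mul]
  simp

theorem fwdDiff_iter_inv (n : ℕ) : ∀ z : ℝ, 0 < z →
    (fwdDiff 1)^[n] (fun x : ℝ => x⁻¹) z = (-1) ^ n * n.factorial / poch z (n + 1) := by
  induction n with
  | zero =>
    intro z _
    simp [poch]
  | succ n ih =>
    intro z hz
    have hz1 : 0 < z + 1 := by linarith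
    rw [Function.iterate_succ_apply', fwdDiff, ih z hz, ih (z + 1) hz1, poch_succ (z + 1) n,
      poch_add_one hz.ne', poch_succ z (n + 1), poch_succ z n, Nat.factorial_succ, pow_succ]
    have h1 := (poch_pos hz n).ne'
    have h2 : z + n ≠ 0 := by positivity
    have h3 : z + (n + 1) ≠ 0 := by positivity
    have h4 : z + 1 + n ≠ 0 := by positivity
    push_cast
    field_simp
    ring

theorem sum_alternating_choose_inv {z : ℝ} (hz : 0 < z) (n : ℕ) :
    ∑ i ∈ Finset.range (n + 1), (-1 : ℝ) ^ (n + i) * n.choose i * (z + i)⁻¹ =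
      (-1) ^ n * n.factorial / poch z (n + 1) := by
  rw [← fwdDiff_iter_inv n z hz, fwdDiff_iter_eq_sum_shift]
  refine Finset.sum_congr rfl fun i hi => ?_
  have hi' : i ≤ n := by simpa [Nat.lt_succ_iff] using hi
  rw [show n + i = (n - i) + 2 * i by omega, pow_add, pow_mul]
  simp

open Polynomial in
-- Dividing by the linear factor, `P(x) / (z + x) = P(-z) / (z + x) + Q(x)` with `deg Q < n`. The
-- difference kills `Q`, and the differences of `1 / x` are explicit.
theorem sum_alternating_choose_eval_div {P : ℝ[X]} {n : ℕ} (hn : 0 < n) (hP : P.natDegree ≤ n)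
    {z : ℝ} (hz : 0 < z) :
    ∑ i ∈ Finset.range (n + 1), (-1 : ℝ) ^ (n + i) * n.choose i * (P.eval (i : ℝ) / (z + i)) =
      P.eval (-z) * ((-1) ^ n * n.factorial / poch z (n + 1)) := by
  set Q := P /ₘ (X - C (-z)) with hQ
  have hdiv : ∀ x : ℝ, P.eval x = P.eval (-z) + (z + x) * Q.eval x := by
    intro x
    have h := congrArg (Polynomial.eval x) (modByMonic_add_div P (X - C (-z)))
    rw [modByMonic_X_sub_C_eq_C_eval, ← hQ] at h
    rw [← h]
    simp only [eval_add, eval_C, eval_mul, eval_sub, eval_X]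
    ring
  have hQd : Q.natDegree < n := by
    rw [hQ, natDegree_divByMonic _ (monic_X_sub_C _), natDegree_X_sub_C]
    omega
  have h0 := sum_alternating_choose_eval hQd
  rw [← sum_alternating_choose_inv hz, Finset.mul_sum, ← sub_eq_zero]
  refine Eq.trans ?_ h0
  rw [← Finset.sum_sub_distrib]
  refine Finset.sum_congr rfl fun i _ => ?_
  have hzi : z + i ≠ 0 := by positivity
  rw [hdiv i]
  field_simp
  ring

/-- The polynomial `y ↦ (x + y)(x + y + 1) ⋯ (x + y + m - 1)`. -/
noncomputable def risePoly (x : ℝ) (m : ℕ) : Polynomial ℝ :=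
  ∏ k ∈ Finset.range m, (Polynomial.X + Polynomial.C (x + k))

theorem eval_risePoly (x : ℝ) (m : ℕ) (y : ℝ) : (risePoly x m).eval y = poch (x + y) m := by
  rw [risePoly, Polynomial.eval_prod, poch]
  refine Finset.prod_congr rfl fun k _ => ?_
  simp
  ring

theorem natDegree_risePoly_le (x : ℝ) (m : ℕ) : (risePoly x m).natDegree ≤ m := by
  refine (Polynomial.natDegree_prod_le _ _).trans ?_
  refine (Finset.sum_le_card_nsmul _ _ 1 fun k _ => ?_).trans (by simp)
  exact (Polynomial.natDegree_X_add_C _).le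

theorem poch_div_poch {a : ℝ} (ha : 0 < a) (i j : ℕ) :
    poch a (i + j) / poch a i = poch (a + i) j := by
  rw [poch_add, mul_div_cancel_left₀ _ (poch_pos ha i).ne']

/-- For `j ≤ p` the quotient is thus a polynomial in `i` of degree `p - j`: the upper parameter of
the `₃F₂` absorbs the denominator of the moment. -/
theorem poch_shift_div_poch {c : ℝ} (hc : 0 < c) {j p : ℕ} (h : j ≤ p) (i : ℕ) :
    poch (c + p) i / poch c (i + j) = poch (c + j + i) (p - j) / poch c p := by
  rw [div_eq_div_iff (poch_pos hc _).ne' (poch_pos hc _).ne', mul_comm, ← poch_add,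
    show p + i = i + j + (p - j) by omega, poch_add]
  push_cast
  rw [show c + (i + j) = c + j + i by ring]
  ring

/-- All four Pochhammer quotients are polynomials in `i`, of total degree `j + l + (p - l) + (r - j)
= p + r < n`. -/
theorem sum_mopCoef_eq_zero {a b c d : ℝ} (ha : 0 < a) (hb : 0 < b) (hc : 0 < c) (hd : 0 < d)
    {n p r j l : ℕ} (hj : j ≤ r) (hl : l ≤ p) (hn : p + r < n) :
    ∑ i ∈ Finset.range (n + 1), mopCoef a b (c + p) (d + r) n i *
      (poch a (i + j) * poch b (i + l) / (poch c (i + l) * poch d (i + j))) = 0 := by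
  have hdeg : (risePoly a j * risePoly b l * risePoly (c + l) (p - l) *
      risePoly (d + j) (r - j)).natDegree < n := by
    refine lt_of_le_of_lt (Polynomial.natDegree_mul_le.trans (add_le_add
      (Polynomial.natDegree_mul_le.trans (add_le_add (Polynomial.natDegree_mul_le.trans
        (add_le_add (natDegree_risePoly_le _ _) (natDegree_risePoly_le _ _)))
        (natDegree_risePoly_le _ _))) (natDegree_risePoly_le _ _))) ?_
    omega
  have h0 := sum_alternating_choose_eval hdeg
  rw [← mul_zero (poch a n * poch b n / (poch (c + p) n * poch (d + r) n) /
    (poch c p * poch d r)), ← h0, Finset.mul_sum]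
  refine Finset.sum_congr rfl fun i _ => ?_
  simp only [Polynomial.eval_mul, eval_risePoly]
  calc mopCoef a b (c + p) (d + r) n i *
        (poch a (i + j) * poch b (i + l) / (poch c (i + l) * poch d (i + j)))
      = (-1) ^ (n + i) * n.choose i * (poch a n * poch b n / (poch (c + p) n * poch (d + r) n)) *
        (poch a (i + j) / poch a i) * (poch b (i + l) / poch b i) *
        (poch (c + p) i / poch c (i + l)) * (poch (d + r) i / poch d (i + j)) := by
        simp only [mopCoef]
        ring
    _ = _ := by
        rw [poch_div_poch ha, poch_div_poch hb, poch_shift_div_poch hc hl,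
          poch_shift_div_poch hd hj]
        ring

/-- One step past the range of `sum_mopCoef_eq_zero`, a single factor `d + r + i` stays in the
denominator. The sum is a nonzero multiple of the numerator at the pole `i = -(d + r)`, which the
two hypotheses keep from vanishing. -/
theorem sum_mopCoef_ne_zero {a b c d : ℝ} (ha : 0 < a) (hb : 0 < b) (hc : 0 < c) (hd : 0 < d)
    {p r : ℕ} (hda : poch (a - (d + r)) (r + 1) ≠ 0) (hdb : poch (b - (d + r)) p ≠ 0) :
    ∑ i ∈ Finset.range (r + 1 + p + 1), mopCoef a b (c + p) (d + r) (r + 1 + p) i *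
      (poch a (i + (r + 1)) * poch b (i + p) / (poch c (i + p) * poch d (i + (r + 1)))) ≠ 0 := by
  have hdeg : (risePoly a (r + 1) * risePoly b p).natDegree ≤ r + 1 + p :=
    Polynomial.natDegree_mul_le.trans
      (add_le_add (natDegree_risePoly_le _ _) (natDegree_risePoly_le _ _))
  have hz : 0 < d + r := by positivity
  have h0 := sum_alternating_choose_eval_div (by omega) hdeg hz
  set n := r + 1 + p with hn
  have hcp : 0 < c + p := by positivity
  have key : ∑ i ∈ Finset.range (n + 1), mopCoef a b (c + p) (d + r) n i *
      (poch a (i + (r + 1)) * poch b (i + p) / (poch c (i + p) * poch d (i + (r + 1)))) =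
      (poch a n * poch b n / (poch (c + p) n * poch (d + r) n) / (poch c p * poch d r)) *
      ((risePoly a (r + 1) * risePoly b p).eval (-(d + r)) *
        ((-1) ^ n * n.factorial / poch (d + r) (n + 1))) := by
    rw [← h0, Finset.mul_sum]
    refine Finset.sum_congr rfl fun i _ => ?_
    simp only [Polynomial.eval_mul, eval_risePoly]
    have hlast : poch (d + r) i / poch d (i + (r + 1)) = 1 / (poch d r * (d + r + i)) := by
      have h1 := (poch_pos hd (i + (r + 1))).ne'
      have h2 := (poch_pos hd r).ne'
      have h3 : d + r + i ≠ 0 := by positivity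
      rw [div_eq_div_iff h1 (mul_ne_zero h2 h3), show i + (r + 1) = r + i + 1 by ring, poch_succ,
        poch_add]
      push_cast
      ring
    calc mopCoef a b (c + p) (d + r) n i *
          (poch a (i + (r + 1)) * poch b (i + p) / (poch c (i + p) * poch d (i + (r + 1))))
        = (-1) ^ (n + i) * n.choose i *
          (poch a n * poch b n / (poch (c + p) n * poch (d + r) n)) *
          (poch a (i + (r + 1)) / poch a i) * (poch b (i + p) / poch b i) *
          (poch (c + p) i / poch c (i + p)) * (poch (d + r) i / poch d (i + (r + 1))) := by
          simp only [mopCoef]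
          ring
      _ = _ := by
          rw [poch_div_poch ha, poch_div_poch hb, poch_shift_div_poch hc le_rfl, hlast, one_div,
            mul_inv]
          simp only [Nat.sub_self, poch_zero]
          ring
  rw [key]
  simp only [Polynomial.eval_mul, eval_risePoly, ← sub_eq_add_neg]
  have := poch_pos ha n
  have := poch_pos hb n
  have := poch_pos hcp n
  have := poch_pos hz n
  have := poch_pos hz (n + 1)
  have := poch_pos hc p
  have := poch_pos hd r
  refine mul_ne_zero (by positivity) (mul_ne_zero (mul_ne_zero hda hdb) ?_)
  exact div_ne_zero (mul_ne_zero (pow_ne_zero _ (by norm_num)) (by positivity)) (by positivity)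

/-! ### The parameters `c_n` and the coefficients `λ` -/

theorem cPrev_even (c d : ℝ) (k : ℕ) : cPrev c d (2 * k) = c + k := by
  simp [cPrev]

theorem cPrev_odd (c d : ℝ) (k : ℕ) : cPrev c d (2 * k + 1) = d + k := by
  have h1 : (2 * k + 1) % 2 = 1 := by omega
  have h2 : (2 * k + 1) / 2 = k := by omega
  simp [cPrev, h1, h2]

theorem cPrev_add_two (c d : ℝ) (n : ℕ) : cPrev c d (n + 2) = cPrev c d n + 1 := by
  obtain ⟨k, rfl | rfl⟩ := n.even_or_odd'
  · rw [show 2 * k + 2 = 2 * (k + 1) by ring, cPrev_even, cPrev_even]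
    push_cast
    ring
  · rw [show 2 * k + 1 + 2 = 2 * (k + 1) + 1 by ring, cPrev_odd, cPrev_odd]
    push_cast
    ring

theorem cPrev_add_one_add_one (c d : ℝ) (n : ℕ) :
    cPrev (c + 1) (d + 1) n = cPrev c d n + 1 := by
  obtain ⟨k, rfl | rfl⟩ := n.even_or_odd'
  · rw [cPrev_even, cPrev_even]
    ring
  · rw [cPrev_odd, cPrev_odd]
    ring

theorem le_cPrev {a c d : ℝ} (hc : a ≤ c) (hd : a ≤ d) (n : ℕ) : a ≤ cPrev c d n := by
  obtain ⟨k, rfl | rfl⟩ := n.even_or_odd'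
  · rw [cPrev_even]
    linarith [(Nat.cast_nonneg k : (0 : ℝ) ≤ k)]
  · rw [cPrev_odd]
    linarith [(Nat.cast_nonneg k : (0 : ℝ) ≤ k)]

theorem le_cPrev_succ {b c d : ℝ} (hc : b ≤ c + 1) (hd : b ≤ d) (n : ℕ) :
    b ≤ cPrev c d (n + 1) := by
  obtain ⟨k, rfl | rfl⟩ := n.even_or_odd'
  · rw [cPrev_odd]
    linarith [(Nat.cast_nonneg k : (0 : ℝ) ≤ k)]
  · rw [show 2 * k + 1 + 1 = 2 * (k + 1) by ring, cPrev_even]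
    push_cast
    linarith [(Nat.cast_nonneg k : (0 : ℝ) ≤ k)]

theorem cPrev_pos {c d : ℝ} (hc : 0 < c) (hd : 0 < d) (n : ℕ) : 0 < cPrev c d n := by
  obtain ⟨k, rfl | rfl⟩ := n.even_or_odd'
  · rw [cPrev_even]
    positivity
  · rw [cPrev_odd]
    positivity

/-- With `n = m + 1` and `c_n - 1 = c_{n-2}`, the denominators become visibly positive. The next
formulas for `lam` serve the same end. -/
theorem lam_add_three (a b c d : ℝ) (m : ℕ) :
    lam a b c d (3 * m + 3) = (m + 1) * (b + m) * (cPrev c d m - a) /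
      ((cPrev c d m + m) * (cPrev c d m + m + 1) * (cPrev c d (m + 1) + m)) := by
  have h1 : (3 * m + 3) % 3 = 0 := by omega
  have h2 : (3 * m + 3) / 3 = m + 1 := by omega
  simp only [lam, h1, h2, if_true]
  rw [show m + 1 + 1 = m + 2 by ring, cPrev_add_two]
  push_cast
  congr 1 <;> ring

theorem lam_add_four (a b c d : ℝ) (m : ℕ) :
    lam a b c d (3 * m + 4) = (m + 1) * (a + m + 1) * (cPrev c d (m + 1) - b) /
      ((cPrev c d m + m + 1) * (cPrev c d (m + 1) + m) * (cPrev c d (m + 1) + m + 1)) := by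
  have h1 : (3 * m + 4) % 3 = 1 := by omega
  have h2 : (3 * m + 4) / 3 = m + 1 := by omega
  simp only [lam, h1, h2, one_ne_zero, if_true, if_false]
  rw [show m + 1 + 1 = m + 2 by ring, cPrev_add_two]
  push_cast
  congr 1 <;> ring

theorem lam_two (a b c d : ℝ) : lam a b c d 2 = a * b / (c * d) := by
  simp [lam]

theorem lam_add_five (a b c d : ℝ) (m : ℕ) :
    lam a b c d (3 * m + 5) = (a + m + 1) * (b + m + 1) * cPrev c d m /
      ((cPrev c d m + m + 1) * (cPrev c d m + m + 2) * (cPrev c d (m + 1) + m + 1)) := by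
  have h1 : (3 * m + 5) % 3 = 2 := by omega
  have h2 : (3 * m + 5) / 3 = m + 1 := by omega
  simp only [lam, h1, h2]
  rw [show m + 1 + 1 = m + 2 by ring, cPrev_add_two]
  simp only [Nat.succ_ne_zero, if_false, OfNat.ofNat_ne_zero, OfNat.ofNat_ne_one]
  push_cast
  congr 1 <;> ring

/-! ### Products with bidiagonal matrices -/

theorem semiMul_apply_of_col (A : SMat) {B : SMat} {m N : ℕ} (h : ∀ k, N ≤ k → B k m = 0)
    (n : ℕ) : (A ⬝∞ B) n m = ∑ k ∈ Finset.range N, A n k * B k m :=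
  tsum_eq_sum fun k hk => by
    rw [h k (by simpa using hk), mul_zero]

theorem lowerBidiag_semiMul_succ {L : SMat} (hL : ∀ n m, m ≠ n → m + 1 ≠ n → L n m = 0)
    (X : SMat) (n m : ℕ) :
    (L ⬝∞ X) (n + 1) m = L (n + 1) n * X n m + L (n + 1) (n + 1) * X (n + 1) m := by
  rw [semiMul_apply_of_row (N := n + 2) (fun k hk => hL _ _ (by omega) (by omega)),
    Finset.sum_range_succ, Finset.sum_range_succ, Finset.sum_eq_zero, zero_add]
  intro k hk
  have := Finset.mem_range.1 hk
  rw [hL _ _ (by omega) (by omega), zero_mul]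

theorem lowerBidiag_semiMul_zero {L : SMat} (hL : ∀ n m, m ≠ n → m + 1 ≠ n → L n m = 0)
    (X : SMat) (m : ℕ) : (L ⬝∞ X) 0 m = L 0 0 * X 0 m := by
  rw [semiMul_apply_of_row (N := 1) (fun k hk => hL _ _ (by omega) (by omega)),
    Finset.sum_range_one]

theorem upperBidiag_semiMul {B : SMat} (hB : ∀ n m, m ≠ n → m ≠ n + 1 → B n m = 0)
    (X : SMat) (n m : ℕ) :
    (B ⬝∞ X) n m = B n n * X n m + B n (n + 1) * X (n + 1) m := by
  rw [semiMul_apply_of_row (N := n + 2) (fun k hk => hB _ _ (by omega) (by omega)),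
    Finset.sum_range_succ, Finset.sum_range_succ, Finset.sum_eq_zero, zero_add]
  intro k hk
  have := Finset.mem_range.1 hk
  rw [hB _ _ (by omega) (by omega), zero_mul]

theorem semiMul_lowerBidiag {L : SMat} (hL : ∀ n m, m ≠ n → m + 1 ≠ n → L n m = 0)
    (X : SMat) (n m : ℕ) :
    (X ⬝∞ L) n m = X n m * L m m + X n (m + 1) * L (m + 1) m := by
  rw [semiMul_apply_of_col (N := m + 2) _ (fun k hk => hL _ _ (by omega) (by omega)),
    Finset.sum_range_succ, Finset.sum_range_succ, Finset.sum_eq_zero, zero_add]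
  intro k hk
  have := Finset.mem_range.1 hk
  rw [hL _ _ (by omega) (by omega), mul_zero]

theorem semiMul_upperBidiag_succ {B : SMat} (hB : ∀ n m, m ≠ n → m ≠ n + 1 → B n m = 0)
    (X : SMat) (n m : ℕ) :
    (X ⬝∞ B) n (m + 1) = X n m * B m (m + 1) + X n (m + 1) * B (m + 1) (m + 1) := by
  rw [semiMul_apply_of_col (N := m + 2) _ (fun k hk => hB _ _ (by omega) (by omega)),
    Finset.sum_range_succ, Finset.sum_range_succ, Finset.sum_eq_zero, zero_add]
  intro k hk
  have := Finset.mem_range.1 hk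
  rw [hB _ _ (by omega) (by omega), mul_zero]

theorem semiMul_upperBidiag_zero {B : SMat} (hB : ∀ n m, m ≠ n → m ≠ n + 1 → B n m = 0)
    (X : SMat) (n : ℕ) : (X ⬝∞ B) n 0 = X n 0 * B 0 0 := by
  rw [semiMul_apply_of_col (N := 1) _ (fun k hk => hB _ _ (by omega) (by omega)),
    Finset.sum_range_one]

theorem rowFinite_of_lowerBidiag {L : SMat} (hL : ∀ n m, m ≠ n → m + 1 ≠ n → L n m = 0) :
    RowFinite L := fun n => ⟨n + 1, fun k hk => hL n k (by omega) (by omega)⟩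

theorem rowFinite_of_upperBidiag {B : SMat} (hB : ∀ n m, m ≠ n → m ≠ n + 1 → B n m = 0) :
    RowFinite B := fun n => ⟨n + 2, fun k hk => hB n k (by omega) (by omega)⟩

theorem rowFinite_transpose_of_lowerBidiag {L : SMat}
    (hL : ∀ n m, m ≠ n → m + 1 ≠ n → L n m = 0) : RowFinite L.transpose := fun n =>
  ⟨n + 2, fun k hk => hL k n (by omega) (by omega)⟩

theorem rowFinite_transpose_of_upperBidiag {B : SMat}
    (hB : ∀ n m, m ≠ n → m ≠ n + 1 → B n m = 0) : RowFinite B.transpose := fun n =>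
  ⟨n + 1, fun k hk => hB k n (by omega) (by omega)⟩

theorem L₁_eq_zero (a b c d : ℝ) (n m : ℕ) (h1 : m ≠ n) (h2 : m + 1 ≠ n) :
    L₁ a b c d n m = 0 := by
  simp [L₁, h1.symm, h2.symm]

theorem L₂_eq_zero (a b c d : ℝ) (n m : ℕ) (h1 : m ≠ n) (h2 : m + 1 ≠ n) :
    L₂ a b c d n m = 0 := by
  simp [L₂, h1.symm, h2.symm]

theorem U_eq_zero (a b c d : ℝ) (n m : ℕ) (h1 : m ≠ n) (h2 : m ≠ n + 1) :
    U a b c d n m = 0 := by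
  simp [U, h1, h2]

theorem L₁_self (a b c d : ℝ) (n : ℕ) : L₁ a b c d n n = 1 := by simp [L₁]

theorem L₂_self (a b c d : ℝ) (n : ℕ) : L₂ a b c d n n = 1 := by simp [L₂]

theorem L₁_succ (a b c d : ℝ) (n : ℕ) : L₁ a b c d (n + 1) n = lam a b c d (3 * n + 3) := by
  simp [L₁]

theorem L₂_succ (a b c d : ℝ) (n : ℕ) : L₂ a b c d (n + 1) n = lam a b c d (3 * n + 4) := by
  simp [L₂]

theorem U_self (a b c d : ℝ) (n : ℕ) : U a b c d n n = lam a b c d (3 * n + 2) := by simp [U]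

theorem U_succ (a b c d : ℝ) (n : ℕ) : U a b c d n (n + 1) = 1 := by simp [U]

theorem semiMul_shiftMat_zero (X : SMat) (n : ℕ) : (X ⬝∞ shiftMat) n 0 = 0 := by
  simp [semiMul, shiftMat]

theorem semiMul_shiftMat_succ (X : SMat) (n m : ℕ) : (X ⬝∞ shiftMat) n (m + 1) = X n m := by
  refine (tsum_eq_single m fun k hk => ?_).trans ?_
  · simp [shiftMat, hk.symm]
  · simp [shiftMat]

theorem shiftMat_semiMul (X : SMat) (n m : ℕ) : (shiftMat ⬝∞ X) n m = X (n + 1) m := by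
  refine (tsum_eq_single (n + 1) fun k hk => ?_).trans ?_
  · simp [shiftMat, hk]
  · simp [shiftMat]

theorem rowFinite_shiftMat : RowFinite shiftMat := fun n =>
  ⟨n + 2, fun k hk => by simp [shiftMat, show k ≠ n + 1 by omega]⟩

/-! ### The type II matrix and its recurrence -/

/-- The coefficients of the type II multiple orthogonal polynomials on the step line. -/
noncomputable def typeII (a b c d : ℝ) : SMat := Matrix.of fun n i =>
  mopCoef a b (cPrev c d n) (cPrev c d (n + 1) - 1) n i

/-- The coefficients of the polynomials between the two lower bidiagonal factors. -/
noncomputable def typeIIMid (a b c d : ℝ) : SMat := Matrix.of fun n i =>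
  mopCoef (a + 1) b (cPrev c d n) (cPrev c d (n + 1)) n i

theorem isLowerUnitri_typeII {a b c d : ℝ} (ha : 0 < a) (hb : 0 < b) (hc : 0 < c) (hd : 0 < d) :
    IsLowerUnitri (typeII a b c d) := by
  refine ⟨fun n => ?_, fun n m h => mopCoef_of_lt _ _ _ _ h⟩
  refine mopCoef_self ha hb (poch_pos (cPrev_pos hc hd n) n).ne' ?_
  -- At `n = 0` the parameter `c_0 - 1 = d - 1` need not be positive, but its empty rising factorial
  -- is `1`.
  rcases n with _ | n
  · simp
  · rw [show n + 1 + 1 = n + 2 by ring, cPrev_add_two, add_sub_cancel_right]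
    exact (poch_pos (cPrev_pos hc hd n) _).ne'

section Recurrence

variable {a b c d : ℝ}

/-- The contiguous relation in `a` and `c_n - 1`. The next lemma uses it in `b` and `c_{n-1}`, which
completes the raising of all four parameters. -/
theorem L₁_semiMul_typeIIMid (ha : 0 < a) (hb : 0 < b) (hc : 0 < c) (hd : 0 < d) :
    L₁ a b c d ⬝∞ typeIIMid a b c d = typeII a b c d := by
  ext n i
  rcases n with _ | m
  · rw [lowerBidiag_semiMul_zero (L₁_eq_zero a b c d), L₁_self]
    simp only [typeII, typeIIMid, Matrix.of_apply]
    rcases i with _ | i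
    · simp [mopCoef]
    · rw [mopCoef_of_lt _ _ _ _ (by omega), mopCoef_of_lt _ _ _ _ (by omega), mul_zero]
  · rw [lowerBidiag_semiMul_succ (L₁_eq_zero a b c d), L₁_self, L₁_succ, lam_add_three]
    simp only [typeII, typeIIMid, Matrix.of_apply]
    rw [show m + 1 + 1 = m + 2 by ring, cPrev_add_two, add_sub_cancel_right,
      mopCoef_contiguous ha hb (cPrev_pos hc hd (m + 1)) (cPrev_pos hc hd m),
      mopCoef_swap_right _ _ (cPrev c d m)]
    ring

theorem L₂_semiMul_typeII (ha : 0 < a) (hb : 0 < b) (hc : 0 < c) (hd : 0 < d) :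
    L₂ a b c d ⬝∞ typeII (a + 1) (b + 1) (c + 1) (d + 1) = typeIIMid a b c d := by
  ext n i
  rcases n with _ | m
  · rw [lowerBidiag_semiMul_zero (L₂_eq_zero a b c d), L₂_self]
    simp only [typeII, typeIIMid, Matrix.of_apply]
    rcases i with _ | i
    · simp [mopCoef]
    · rw [mopCoef_of_lt _ _ _ _ (by omega), mopCoef_of_lt _ _ _ _ (by omega), mul_zero]
  · rw [lowerBidiag_semiMul_succ (L₂_eq_zero a b c d), L₂_self, L₂_succ, lam_add_four]
    simp only [typeII, typeIIMid, Matrix.of_apply, cPrev_add_one_add_one, add_sub_cancel_right]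
    have hp := cPrev_pos hc hd m
    rw [show m + 1 + 1 = m + 2 by ring, cPrev_add_two, mopCoef_swap (a + 1) b,
      mopCoef_contiguous hb (by linarith) (by linarith : 0 < cPrev c d m + 1)
        (cPrev_pos hc hd (m + 1)),
      mopCoef_swap (b + 1), mopCoef_swap (b + 1)]
    have e : ((m : ℝ) + 1) * (a + 1 + m) * (cPrev c d (m + 1) - b) /
        ((cPrev c d (m + 1) + m) * (cPrev c d (m + 1) + m + 1) * (cPrev c d m + 1 + m)) =
        (m + 1) * (a + m + 1) * (cPrev c d (m + 1) - b) /
      ((cPrev c d m + m + 1) * (cPrev c d (m + 1) + m) * (cPrev c d (m + 1) + m + 1)) := by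
      congr 1 <;> ring
    rw [e, mopCoef_swap_right _ _ (cPrev c d (m + 1) + 1),
      mopCoef_swap_right _ _ (cPrev c d (m + 1))]
    ring

theorem U_semiMul_typeII (ha : 0 < a) (hb : 0 < b) (hc : 0 < c) (hd : 0 < d) :
    U a b c d ⬝∞ typeII a b c d = typeII (a + 1) (b + 1) (c + 1) (d + 1) ⬝∞ shiftMat := by
  ext n i
  rw [upperBidiag_semiMul (U_eq_zero a b c d), U_self, U_succ, one_mul]
  -- Row `0` is checked by hand: there the upper parameter `d - 1` may fail to be positive, and `λ₂`
  -- has its factor `d - 1` cancelled.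
  rcases n with _ | m
  · have e0 : cPrev c d 0 = c := by simpa using cPrev_even c d 0
    have e1 : cPrev c d 1 = d := by simpa using cPrev_odd c d 0
    have e2 : cPrev c d 2 = c + 1 := by rw [cPrev_add_two c d 0, e0]
    rw [mul_zero, zero_add, lam_two]
    rcases i with _ | _ | i
    · rw [semiMul_shiftMat_zero]
      simp only [typeII, Matrix.of_apply, mopCoef]
      simp [poch, e1, e2]
      field_simp
      ring
    · rw [semiMul_shiftMat_succ]
      simp only [typeII, Matrix.of_apply, mopCoef]
      simp [poch, e1, e2]
      field_simp
    · rw [semiMul_shiftMat_succ]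
      simp only [typeII, Matrix.of_apply]
      rw [mopCoef_of_lt _ _ _ _ (by omega), mopCoef_of_lt _ _ _ _ (by omega),
        mopCoef_of_lt _ _ _ _ (by omega)]
      ring
  · have hm := cPrev_pos hc hd m
    have hm1 := cPrev_pos hc hd (m + 1)
    have e : lam a b c d (3 * (m + 1) + 2) =
        (a + (m + 1 : ℕ)) * (b + (m + 1 : ℕ)) * cPrev c d m /
        ((cPrev c d m + (m + 1 : ℕ)) * (cPrev c d m + (m + 1 : ℕ) + 1) *
          (cPrev c d (m + 1) + (m + 1 : ℕ))) := by
      rw [show 3 * (m + 1) + 2 = 3 * m + 5 by ring, lam_add_five]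
      push_cast
      congr 1 <;> ring
    rw [e]
    have e2 : cPrev c d (m + 1 + 1 + 1) - 1 = cPrev c d (m + 1) := by
      rw [show m + 1 + 1 + 1 = m + 1 + 2 by ring, cPrev_add_two, add_sub_cancel_right]
    rcases i with _ | i
    · rw [semiMul_shiftMat_zero]
      simp only [typeII, Matrix.of_apply]
      rw [e2, show m + 1 + 1 = m + 2 by ring, cPrev_add_two, add_sub_cancel_right]
      exact mopCoef_zero_right ha hb hm1 hm (m + 1)
    · rw [semiMul_shiftMat_succ]
      simp only [typeII, Matrix.of_apply, cPrev_add_one_add_one]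
      rw [e2, show m + 1 + 1 = m + 2 by ring, cPrev_add_two, add_sub_cancel_right,
        add_sub_cancel_right]
      exact mopCoef_shift ha hb hm1 hm (m + 1) i

/-- The recurrence relation of the type II polynomials, with factorized recurrence matrix. -/
theorem factorized_semiMul_typeII (ha : 0 < a) (hb : 0 < b) (hc : 0 < c) (hd : 0 < d) :
    L₁ a b c d ⬝∞ (L₂ a b c d ⬝∞ U a b c d) ⬝∞ typeII a b c d = typeII a b c d ⬝∞ shiftMat := by
  have h1 := rowFinite_of_lowerBidiag (L₁_eq_zero a b c d)
  have h2 := rowFinite_of_lowerBidiag (L₂_eq_zero a b c d)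
  have h3 := rowFinite_of_upperBidiag (U_eq_zero a b c d)
  have h4 := (isLowerUnitri_typeII (by linarith : 0 < a + 1) (by linarith : 0 < b + 1)
    (by linarith : 0 < c + 1) (by linarith : 0 < d + 1)).rowFinite
  rw [semiMul_assoc h1 (h2.semiMul h3), semiMul_assoc h2 h3, U_semiMul_typeII ha hb hc hd,
    ← semiMul_assoc h2 h4, ← semiMul_assoc h1 (h2.semiMul h4),
    L₂_semiMul_typeII ha hb hc hd, L₁_semiMul_typeIIMid ha hb hc hd]

/-! ### Orthogonality -/

/-- In terms of the original parameters the second weight merely advances the indices of `b` and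
`c`. This is why the alternating sums carry two separate offsets `j` and `l`. -/
theorem mom_add_one_eq (hb : 0 < b) (hc : 0 < c) (i j : ℕ) :
    mom a (b + 1) (c + 1) d (i + j) = c / b * (poch a (i + j) * poch b (i + (j + 1)) /
      (poch c (i + (j + 1)) * poch d (i + j))) := by
  rw [mom, ← add_assoc, poch_succ' b, poch_succ' c]
  field_simp

theorem typeII_odd_eq (n i k : ℕ) (hn : n = 2 * k + 1) :
    typeII a b c d n i = mopCoef a b (c + k) (d + k) n i := by
  subst hn
  simp only [typeII, Matrix.of_apply]
  rw [show 2 * k + 1 + 1 = 2 * k + 2 by ring, cPrev_add_two, cPrev_odd, cPrev_even,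
    add_sub_cancel_right, mopCoef_swap_right]

theorem typeII_even_eq (n i k : ℕ) (hn : n = 2 * (k + 1)) :
    typeII a b c d n i = mopCoef a b (c + (k + 1 : ℕ)) (d + k) n i := by
  subst hn
  simp only [typeII, Matrix.of_apply]
  rw [show 2 * (k + 1) + 1 = 2 * k + 1 + 2 by ring, cPrev_add_two, cPrev_odd, cPrev_even,
    add_sub_cancel_right]

/-- Row `n` has upper parameters `c + p`, `d + r` with `p + r = n - 1`, so the degree bound is just
met. The condition `m < n` says exactly that the offsets of column `m` stay within `r` and `p`. -/
theorem typeII_orthogonal (ha : 0 < a) (hb : 0 < b) (hc : 0 < c) (hd : 0 < d)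
    (hδ : 0 < c + d - a - b) {n m : ℕ} (h : m < n) :
    (typeII a b c d ⬝∞ momentMatrix a b c d) n m = 0 := by
  rw [(isLowerUnitri_typeII ha hb hc hd).semiMul_apply]
  obtain ⟨j, rfl | rfl⟩ := m.even_or_odd'
  · simp_rw [momentMatrix_even ha hb hc hd hδ, mom]
    obtain ⟨k, hn | hn⟩ := n.even_or_odd'
    · obtain ⟨k, rfl⟩ : ∃ k', k = k' + 1 := ⟨k - 1, by omega⟩
      simp_rw [typeII_even_eq n _ k hn]
      exact sum_mopCoef_eq_zero ha hb hc hd (by omega) (by omega) (by omega)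
    · simp_rw [typeII_odd_eq n _ k hn]
      exact sum_mopCoef_eq_zero ha hb hc hd (by omega) (by omega) (by omega)
  · simp_rw [momentMatrix_odd ha hb hc hd hδ, mom_add_one_eq hb hc, mul_left_comm _ (c / b)]
    rw [← Finset.mul_sum]
    refine mul_eq_zero_of_right _ ?_
    obtain ⟨k, hn | hn⟩ := n.even_or_odd'
    · obtain ⟨k, rfl⟩ : ∃ k', k = k' + 1 := ⟨k - 1, by omega⟩
      simp_rw [typeII_even_eq n _ k hn]
      exact sum_mopCoef_eq_zero ha hb hc hd (by omega) (by omega) (by omega)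
    · simp_rw [typeII_odd_eq n _ k hn]
      exact sum_mopCoef_eq_zero ha hb hc hd (by omega) (by omega) (by omega)

theorem poch_sub_ne_zero {x y : ℝ} {r p : ℕ} (h : ∀ k < p, x + k ≠ y + r) :
    poch (x - (y + r)) p ≠ 0 := by
  rw [poch, Finset.prod_ne_zero_iff]
  intro k hk h0
  exact h k (Finset.mem_range.1 hk) (by linarith)

/-- For even `n > 0` the surviving pole comes from `d`, and `a, b < d` exclude a zero there. For odd
`n` it comes from `c`, where `c - b ∉ {0, -1, …}` and `a ≤ c` are used. -/
theorem typeII_moment_self_ne_zero (ha : 0 < a) (hb : 0 < b) (had : a < d) (hbd : b < d)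
    (hac : a ≤ c) (hperfect : ∀ k : ℕ, c - b ≠ -(k : ℝ)) (hδ : 0 < c + d - a - b) (n : ℕ) :
    (typeII a b c d ⬝∞ momentMatrix a b c d) n n ≠ 0 := by
  have hc : 0 < c := by linarith
  have hd : 0 < d := by linarith
  rw [(isLowerUnitri_typeII ha hb hc hd).semiMul_apply]
  obtain ⟨k, hn | hn⟩ := n.even_or_odd'
  · rcases k with _ | k
    · subst hn
      have h00 := momentMatrix_even ha hb hc hd hδ 0 0
      have h1 : momentMatrix a b c d 0 0 = 1 := by simpa [mom] using h00
      rw [mul_zero, zero_add, Finset.sum_range_one, h1, (isLowerUnitri_typeII ha hb hc hd).1]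
      norm_num
    · have hm : ∀ i, momentMatrix a b c d i n = mom a b c d (i + (k + 1)) := fun i => by
        rw [hn, momentMatrix_even ha hb hc hd hδ]
      simp_rw [hm, mom, typeII_even_eq n _ k hn]
      rw [show n = k + 1 + (k + 1) by omega]
      refine sum_mopCoef_ne_zero ha hb hc hd (poch_sub_ne_zero ?_) (poch_sub_ne_zero ?_)
      all_goals
        intro i hi
        have : (i : ℝ) ≤ k := by exact_mod_cast Nat.lt_succ_iff.1 hi
        linarith
  · have hm : ∀ i, momentMatrix a b c d i n = mom a (b + 1) (c + 1) d (i + k) := fun i => by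
      rw [hn, momentMatrix_odd ha hb hc hd hδ]
    simp_rw [hm, mom_add_one_eq hb hc, mul_left_comm _ (c / b)]
    rw [← Finset.mul_sum]
    refine mul_ne_zero (by positivity) ?_
    simp_rw [typeII_odd_eq n _ k hn]
    rw [show n = k + 1 + k by omega]
    -- Exchanging `a` with `b` and `c` with `d` moves the pole from `c` to the position treated by
    -- `sum_mopCoef_ne_zero`.
    simp_rw [mopCoef_swap a b, mul_comm (poch a _), mul_comm (poch c _)]
    refine sum_mopCoef_ne_zero hb ha hd hc (poch_sub_ne_zero ?_) (poch_sub_ne_zero ?_)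
    · intro i hi h
      apply hperfect (k - i)
      rw [Nat.cast_sub (by omega)]
      linarith
    -- Only `i < k` occurs here, so `a = c` is harmless.
    · intro i hi
      have : (i : ℝ) < k := by exact_mod_cast hi
      linarith

end Recurrence

/-! ### The values of the type I linear forms at `1` -/

/-- The value at `1` of the type I linear form of index `n`. -/
noncomputable def formOne (a b c d : ℝ) (n : ℕ) : ℝ :=
  ∏ m ∈ Finset.range n, (cPrev c d m + m) * (cPrev c d m + m + 1) * (cPrev c d (m + 1) + m) /
    ((m + 1) * (a + m) * (b + m))

section Values

variable {a b c d : ℝ}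

theorem formOne_succ (n : ℕ) : formOne a b c d (n + 1) = formOne a b c d n *
    ((cPrev c d n + n) * (cPrev c d n + n + 1) * (cPrev c d (n + 1) + n) /
      ((n + 1) * (a + n) * (b + n))) :=
  Finset.prod_range_succ _ _

theorem formOne_pos (ha : 0 < a) (hb : 0 < b) (hc : 0 < c) (hd : 0 < d) (n : ℕ) :
    0 < formOne a b c d n := by
  refine Finset.prod_pos fun m _ => ?_
  have := cPrev_pos hc hd m
  have := cPrev_pos hc hd (m + 1)
  positivity

/-- The ratio of consecutive values cancels the denominator of `λ_{3n+3}`, so the second term is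
`(c_{n-1} - a) / (a + n)` times the first. The analogous factor for `λ_{3n+4}` is `(c_n - b) / (b +
n)`. -/
theorem formOne_add_lam (ha : 0 < a) (hb : 0 < b) (hc : 0 < c) (hd : 0 < d) (n : ℕ) :
    formOne a b c d n + lam a b c d (3 * n + 3) * formOne a b c d (n + 1) =
      formOne a b c d n * ((cPrev c d n + n) / (a + n)) := by
  have := cPrev_pos hc hd n
  have := cPrev_pos hc hd (n + 1)
  rw [formOne_succ, lam_add_three]
  field_simp
  ring

theorem formOne_add_lam₂ (ha : 0 < a) (hb : 0 < b) (hc : 0 < c) (hd : 0 < d) (n : ℕ) :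
    formOne a b c d n * ((cPrev c d n + n) / (a + n)) + lam a b c d (3 * n + 4) *
      (formOne a b c d (n + 1) * ((cPrev c d (n + 1) + (n + 1 : ℕ)) / (a + (n + 1 : ℕ)))) =
      formOne a b c d n * ((cPrev c d n + n) * (cPrev c d (n + 1) + n) /
        ((a + n) * (b + n))) := by
  have := cPrev_pos hc hd n
  have := cPrev_pos hc hd (n + 1)
  have h1 : cPrev c d (n + 1) + (n + 1) ≠ 0 := by positivity
  have h2 : a + (n + 1) ≠ 0 := by positivity
  rw [formOne_succ, lam_add_four]
  push_cast
  field_simp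
  ring

theorem lam_mul_formOne (ha : 0 < a) (hb : 0 < b) (hc : 0 < c) (hd : 0 < d) (n : ℕ) :
    lam a b c d (3 * (n + 1) + 2) * (formOne a b c d (n + 1) *
      ((cPrev c d (n + 1) + (n + 1 : ℕ)) * (cPrev c d (n + 1 + 1) + (n + 1 : ℕ)) /
        ((a + (n + 1 : ℕ)) * (b + (n + 1 : ℕ))))) =
      formOne a b c d (n + 1) * (cPrev c d n / (cPrev c d n + n + 1)) := by
  have := cPrev_pos hc hd n
  have := cPrev_pos hc hd (n + 1)
  have h1 : cPrev c d (n + 1) + (n + 1) ≠ 0 := by positivity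
  have h2 : a + (n + 1) ≠ 0 := by positivity
  have h3 : b + (n + 1) ≠ 0 := by positivity
  have h4 : cPrev c d n + n + 2 ≠ 0 := by positivity
  rw [show 3 * (n + 1) + 2 = 3 * n + 5 by ring, lam_add_five, show n + 1 + 1 = n + 2 by ring,
    cPrev_add_two]
  push_cast
  field_simp
  ring

theorem formOne_mul_eq_succ (ha : 0 < a) (hb : 0 < b) (hc : 0 < c) (hd : 0 < d) (n : ℕ) :
    formOne a b c d n * ((cPrev c d n + n) * (cPrev c d (n + 1) + n) / ((a + n) * (b + n))) =
      formOne a b c d (n + 1) * ((n + 1) / (cPrev c d n + n + 1)) := by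
  have := cPrev_pos hc hd n
  have := cPrev_pos hc hd (n + 1)
  rw [formOne_succ]
  field_simp

theorem lam_two_mul_formOne (ha : 0 < a) (hb : 0 < b) (hc : 0 < c) (hd : 0 < d) :
    lam a b c d 2 * (formOne a b c d 0 * ((cPrev c d 0 + (0 : ℕ)) * (cPrev c d (0 + 1) + (0 : ℕ)) /
      ((a + (0 : ℕ)) * (b + (0 : ℕ))))) = 1 := by
  rw [lam_two]
  simp only [formOne, cPrev]
  simp
  field_simp

/-! ### Identification of the values at `1` through a left fixed vector of the Jacobi matrix -/

/-- The matrix whose rows all equal the vector of the values `formOne`. -/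
noncomputable def formOneMat (a b c d : ℝ) : SMat := Matrix.of fun _ n => formOne a b c d n

theorem formOneMat_semiMul_factorized (ha : 0 < a) (hb : 0 < b) (hc : 0 < c) (hd : 0 < d) :
    formOneMat a b c d ⬝∞ (L₁ a b c d ⬝∞ (L₂ a b c d ⬝∞ U a b c d)) = formOneMat a b c d := by
  have t2 := rowFinite_transpose_of_lowerBidiag (L₂_eq_zero a b c d)
  have t3 := rowFinite_transpose_of_upperBidiag (U_eq_zero a b c d)
  have t1 := rowFinite_transpose_of_lowerBidiag (L₁_eq_zero a b c d)
  have t23 : RowFinite (L₂ a b c d ⬝∞ U a b c d).transpose := by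
    rw [semiMul_transpose]
    exact t3.semiMul t2
  rw [← semiMul_assoc_of_transpose _ t1 t23, ← semiMul_assoc_of_transpose _ t2 t3]
  have e1 : ∀ i n, (formOneMat a b c d ⬝∞ L₁ a b c d) i n =
      formOne a b c d n * ((cPrev c d n + n) / (a + n)) := fun i n => by
    rw [semiMul_lowerBidiag (L₁_eq_zero a b c d), L₁_self, L₁_succ,
      ← formOne_add_lam ha hb hc hd, formOneMat, Matrix.of_apply, Matrix.of_apply]
    ring
  have e2 : ∀ i n, (formOneMat a b c d ⬝∞ L₁ a b c d ⬝∞ L₂ a b c d) i n =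
      formOne a b c d n * ((cPrev c d n + n) * (cPrev c d (n + 1) + n) /
        ((a + n) * (b + n))) := fun i n => by
    rw [semiMul_lowerBidiag (L₂_eq_zero a b c d), L₂_self, L₂_succ, e1, e1,
      ← formOne_add_lam₂ ha hb hc hd]
    ring
  ext i n
  rcases n with _ | n
  · rw [semiMul_upperBidiag_zero (U_eq_zero a b c d), U_self, e2, mul_comm, mul_zero, zero_add,
      lam_two_mul_formOne ha hb hc hd]
    simp [formOneMat, formOne]
  -- The two contributions to column `n + 1` are the fractions `(n + 1) / (c_{n-1} + n + 1)` and
  -- `c_{n-1} / (c_{n-1} + n + 1)` of `formOne (n + 1)`.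
  · rw [semiMul_upperBidiag_succ (U_eq_zero a b c d), U_self, U_succ, e2, e2,
      formOne_mul_eq_succ ha hb hc hd, mul_comm (formOne a b c d (n + 1) * _) (lam _ _ _ _ _),
      lam_mul_formOne ha hb hc hd, formOneMat, Matrix.of_apply]
    have := cPrev_pos hc hd n
    field_simp
    ring

theorem momentMatrix_shift (ha : 0 < a) (hb : 0 < b) (hc : 0 < c) (hd : 0 < d)
    (hδ : 0 < c + d - a - b) (i m : ℕ) :
    momentMatrix a b c d (i + 1) m = momentMatrix a b c d i (m + 2) := by
  obtain ⟨j, rfl | rfl⟩ := m.even_or_odd'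
  · rw [show 2 * j + 2 = 2 * (j + 1) by ring, momentMatrix_even ha hb hc hd hδ,
      momentMatrix_even ha hb hc hd hδ, add_right_comm, add_assoc]
  · rw [show 2 * j + 1 + 2 = 2 * (j + 1) + 1 by ring, momentMatrix_odd ha hb hc hd hδ,
      momentMatrix_odd ha hb hc hd hδ, add_right_comm, add_assoc]

/-- Both the recurrence and the Hankel-type symmetry of `g` express multiplication by `x`: `J S g =
S Λ g`, and `Λ g` is `g` moved by two columns. -/
theorem factorized_semiMul_moment (ha : 0 < a) (hb : 0 < b) (hc : 0 < c) (hd : 0 < d)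
    (hδ : 0 < c + d - a - b) (n m : ℕ) :
    (L₁ a b c d ⬝∞ (L₂ a b c d ⬝∞ U a b c d) ⬝∞ (typeII a b c d ⬝∞ momentMatrix a b c d)) n m =
      (typeII a b c d ⬝∞ momentMatrix a b c d) n (m + 2) := by
  have hS := isLowerUnitri_typeII ha hb hc hd
  have hJ := (rowFinite_of_lowerBidiag (L₁_eq_zero a b c d)).semiMul
    ((rowFinite_of_lowerBidiag (L₂_eq_zero a b c d)).semiMul
      (rowFinite_of_upperBidiag (U_eq_zero a b c d)))
  rw [← semiMul_assoc hJ hS.rowFinite, factorized_semiMul_typeII ha hb hc hd,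
    semiMul_assoc hS.rowFinite rowFinite_shiftMat, hS.semiMul_apply, hS.semiMul_apply]
  refine Finset.sum_congr rfl fun i _ => ?_
  rw [shiftMat_semiMul, momentMatrix_shift ha hb hc hd hδ]

/-- The value at `1` of the undressed linear forms. -/
theorem xi_one (k : ℕ) : xi a b c d 1 (2 * k) = 1 ∧ xi a b c d 1 (2 * k + 1) = c / b := by
  have h1 : (2 * k + 1) % 2 = 1 := by omega
  simp [xi, X₁, X₂, w₁_one, w₂_one, h1]

/-- Since `v R = (v J) R = v (J R)` and `J R` is `R` moved by two columns, `v R` has period two, as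
has `ξ(1)`. It remains to compare two entries. -/
theorem formOneMat_semiMul_moment (ha : 0 < a) (hb : 0 < b) (hc : 0 < c) (hd : 0 < d)
    (hδ : 0 < c + d - a - b) (i j : ℕ) :
    (formOneMat a b c d ⬝∞ (typeII a b c d ⬝∞ momentMatrix a b c d)) i j = xi a b c d 1 j := by
  have hS := isLowerUnitri_typeII ha hb hc hd
  set R := typeII a b c d ⬝∞ momentMatrix a b c d with hR
  have hR0 : ∀ m k, m < k → R k m = 0 := fun m k hk => typeII_orthogonal ha hb hc hd hδ hk
  have hRt : RowFinite R.transpose := fun m => ⟨m + 1, fun k hk => hR0 m k hk⟩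
  have tJ : RowFinite (L₁ a b c d ⬝∞ (L₂ a b c d ⬝∞ U a b c d)).transpose := by
    rw [semiMul_transpose, semiMul_transpose]
    exact ((rowFinite_transpose_of_upperBidiag (U_eq_zero a b c d)).semiMul
      (rowFinite_transpose_of_lowerBidiag (L₂_eq_zero a b c d))).semiMul
      (rowFinite_transpose_of_lowerBidiag (L₁_eq_zero a b c d))
  have hstep : ∀ j, (formOneMat a b c d ⬝∞ R) i (j + 2) = (formOneMat a b c d ⬝∞ R) i j := by
    intro j
    conv_rhs => rw [← formOneMat_semiMul_factorized ha hb hc hd,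
      semiMul_assoc_of_transpose _ tJ hRt]
    refine tsum_congr fun k => ?_
    rw [factorized_semiMul_moment ha hb hc hd hδ]
  have g00 : momentMatrix a b c d 0 0 = 1 := by
    simpa [mom] using momentMatrix_even ha hb hc hd hδ 0 0
  have g01 : momentMatrix a b c d 0 1 = 1 := by
    simpa [mom] using momentMatrix_odd ha hb hc hd hδ 0 0
  have g11 : momentMatrix a b c d 1 1 = a * (b + 1) / ((c + 1) * d) := by
    simpa [mom, poch] using momentMatrix_odd ha hb hc hd hδ 1 0
  have R00 : R 0 0 = 1 := by
    rw [hR, hS.semiMul_apply, Finset.sum_range_one, hS.1, g00, one_mul]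
  have R01 : R 0 1 = 1 := by
    rw [hR, hS.semiMul_apply, Finset.sum_range_one, hS.1, g01, one_mul]
  have S10 : typeII a b c d 1 0 = -(a * b / (c * d)) := by
    rw [typeII_odd_eq 1 0 0 rfl]
    simp [mopCoef, poch]
    field_simp
  have R11 : R 1 1 = a * (b + 1) / ((c + 1) * d) - a * b / (c * d) := by
    rw [hR, hS.semiMul_apply, Finset.sum_range_succ, Finset.sum_range_one, hS.1, g01, g11, S10]
    ring
  have hQ1 : formOne a b c d 1 = c * (c + 1) * d / (a * b) := by
    simp [formOne, cPrev]
  have hbase : (formOneMat a b c d ⬝∞ R) i 0 = xi a b c d 1 0 ∧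
      (formOneMat a b c d ⬝∞ R) i 1 = xi a b c d 1 1 := by
    constructor
    · rw [semiMul_apply_of_col (N := 1) _ (fun k hk => hR0 0 k hk),
        Finset.sum_range_one, R00, (xi_one 0).1]
      simp [formOneMat, formOne]
    · rw [semiMul_apply_of_col (N := 2) _ (fun k hk => hR0 1 k hk),
        Finset.sum_range_succ, Finset.sum_range_one, R01, R11, (xi_one 0).2, formOneMat,
        Matrix.of_apply, Matrix.of_apply, hQ1]
      simp only [formOne, Finset.range_zero, Finset.prod_empty]
      field_simp
      ring
  have hxi : ∀ j, xi a b c d 1 (j + 2) = xi a b c d 1 j := by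
    intro j
    obtain ⟨k, rfl | rfl⟩ := j.even_or_odd'
    · rw [show 2 * k + 2 = 2 * (k + 1) by ring, (xi_one _).1, (xi_one _).1]
    · rw [show 2 * k + 1 + 2 = 2 * (k + 1) + 1 by ring, (xi_one _).2, (xi_one _).2]
  induction j using Nat.twoStepInduction with
  | zero => exact hbase.1
  | one => exact hbase.2
  | more n ih _ => rw [hstep, hxi, ih]

theorem exists_gaussBorel (ha : 0 < a) (hb : 0 < b) (had : a < d) (hbd : b < d)
    (hac : a ≤ c) (hperfect : ∀ k : ℕ, c - b ≠ -(k : ℝ)) (hδ : 0 < c + d - a - b) :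
    ∃ F, IsGaussBorel (momentMatrix a b c d) F ∧ F.S = typeII a b c d := by
  have hc : 0 < c := by linarith
  have hd : 0 < d := by linarith
  exact ⟨borelOfS (momentMatrix a b c d) (typeII a b c d),
    isGaussBorel_borelOfS (isLowerUnitri_typeII ha hb hc hd)
      (fun _ _ h => typeII_orthogonal ha hb hc hd hδ h)
      (typeII_moment_self_ne_zero ha hb had hbd hac hperfect hδ), rfl⟩

/-- Inserting `S g = H S̃⁻ᵀ` into `v (S g) = ξ(1)ᵀ` gives `S̃⁻¹ (H v) = ξ(1)`, hence `v = H⁻¹ S̃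
ξ(1)`, which is the definition of `q(1)`. -/
theorem q_one_eq (ha : 0 < a) (hb : 0 < b) (hc : 0 < c) (hd : 0 < d)
    (hδ : 0 < c + d - a - b) {F : BorelData} (hF : IsGaussBorel (momentMatrix a b c d) F)
    (hFS : F.S = typeII a b c d) (n : ℕ) : q a b c d F n 1 = formOne a b c d n := by
  obtain ⟨_, hSt, hH, hg⟩ := isGaussBorel_iff.1 hF
  rw [hFS] at hg
  have hV := hSt.lowerInv
  set y : SMat := Matrix.of fun m _ => F.H m * formOne a b c d m with hy
  have hxi : ∀ j, xi a b c d 1 j = (lowerInv F.St ⬝∞ y) j 0 := by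
    intro j
    rw [← formOneMat_semiMul_moment ha hb hc hd hδ 0 j]
    refine tsum_congr fun k => ?_
    rw [hg, hy, formOneMat, Matrix.of_apply, Matrix.of_apply]
    ring
  have h1 : ∑ j ∈ Finset.range (n + 1), F.St n j * xi a b c d 1 j = F.H n * formOne a b c d n := by
    simp_rw [hxi]
    rw [← hSt.semiMul_apply, ← semiMul_assoc hSt.rowFinite hV.rowFinite, semiMul_lowerInv hSt,
      one_semiMul, hy, Matrix.of_apply]
  rw [q, A₁, A₂, mul_left_comm, mul_left_comm (w₂ a b c d 1), ← mul_add, Finset.mul_sum,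
    Finset.mul_sum, ← Finset.sum_add_distrib, inv_mul_eq_iff_eq_mul₀ (hH n), ← h1]
  refine Finset.sum_congr rfl fun j _ => ?_
  rw [xi]
  ring

theorem jacobi_eq (ha : 0 < a) (hb : 0 < b) (hc : 0 < c) (hd : 0 < d) {F : BorelData}
    (hFS : F.S = typeII a b c d) :
    jacobi F = L₁ a b c d ⬝∞ (L₂ a b c d ⬝∞ U a b c d) := by
  have hS := isLowerUnitri_typeII ha hb hc hd
  have hJ := (rowFinite_of_lowerBidiag (L₁_eq_zero a b c d)).semiMul
    ((rowFinite_of_lowerBidiag (L₂_eq_zero a b c d)).semiMul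
      (rowFinite_of_upperBidiag (U_eq_zero a b c d)))
  rw [jacobi, hFS, ← factorized_semiMul_typeII ha hb hc hd, semiMul_assoc hJ hS.rowFinite,
    semiMul_lowerInv hS, semiMul_one]

/-! ### The three stochastic factors -/

theorem isPureBirth_of {P : SMat} (h0 : ∀ n, 0 ≤ P n n) (h1 : ∀ n, 0 ≤ P n (n + 1))
    (hsum : ∀ n, P n n + P n (n + 1) = 1) (hz : ∀ n m, m ≠ n → m ≠ n + 1 → P n m = 0) :
    IsPureBirth P := by
  refine ⟨⟨fun n m => ?_, fun n => ?_⟩, hz⟩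
  · by_cases hm : m = n
    · exact hm ▸ h0 n
    · by_cases hm' : m = n + 1
      · exact hm' ▸ h1 n
      · exact (hz n m hm hm').ge
  · have := hasSum_sum_of_ne_finset_zero (L := SummationFilter.unconditional ℕ)
        (f := fun m => P n m) (s := {n, n + 1}) fun m hm => by
      simp only [Finset.mem_insert, Finset.mem_singleton, not_or] at hm
      exact hz n m hm.1 hm.2
    rwa [Finset.sum_pair (by omega), hsum] at this

theorem isPureDeath_of {P : SMat} (h00 : P 0 0 = 1) (h0 : ∀ n, 0 ≤ P (n + 1) (n + 1))
    (h1 : ∀ n, 0 ≤ P (n + 1) n) (hsum : ∀ n, P (n + 1) n + P (n + 1) (n + 1) = 1)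
    (hz : ∀ n m, m ≠ n → m + 1 ≠ n → P n m = 0) : IsPureDeath P := by
  refine ⟨⟨fun n m => ?_, fun n => ?_⟩, hz⟩
  · by_cases hm : m = n
    · subst hm
      rcases m with _ | m
      · rw [h00]
        exact zero_le_one
      · exact h0 m
    · by_cases hm' : m + 1 = n
      · exact hm' ▸ h1 m
      · exact (hz n m hm hm').ge
  · rcases n with _ | n
    · rw [← h00]
      exact hasSum_single 0 fun m hm => hz 0 m hm (by omega)
    · have := hasSum_sum_of_ne_finset_zero (L := SummationFilter.unconditional ℕ)
        (f := fun m => P (n + 1) m) (s := {n, n + 1}) fun m hm => by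
          simp only [Finset.mem_insert, Finset.mem_singleton, not_or] at hm
          exact hz _ m hm.2 (by omega)
      rwa [Finset.sum_pair (by omega), hsum] at this

theorem scaled_semiMul {A B A' B' : SMat} {x y z : ℕ → ℝ} (hy : ∀ k, y k ≠ 0)
    (hA : ∀ n k, A' n k = x n * A n k * y k) (hB : ∀ k m, B' k m = 1 / y k * B k m * z m)
    (n m : ℕ) : (A' ⬝∞ B') n m = x n * (A ⬝∞ B) n m * z m := by
  rw [semiMul, semiMul, ← tsum_mul_left, ← tsum_mul_right]
  refine tsum_congr fun k => ?_
  rw [hA, hB]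
  field_simp [hy k]

theorem dI₁_eq (ha : 0 < a) (hb : 0 < b) (hc : 0 < c) (hd : 0 < d) {F : BorelData}
    (hq : ∀ n, q a b c d F n 1 = formOne a b c d n) (n : ℕ) :
    dI₁ a b c d F n = formOne a b c d n * ((cPrev c d n + n) / (a + n)) := by
  rw [dI₁, hq, hq, formOne_add_lam ha hb hc hd]

theorem dI₂_eq (ha : 0 < a) (hb : 0 < b) (hc : 0 < c) (hd : 0 < d) {F : BorelData}
    (hq : ∀ n, q a b c d F n 1 = formOne a b c d n) (n : ℕ) :
    dI₂ a b c d F n = formOne a b c d n *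
      ((cPrev c d n + n) * (cPrev c d (n + 1) + n) / ((a + n) * (b + n))) := by
  rw [dI₂, hq, hq, hq, ← formOne_add_lam₂ ha hb hc hd, ← formOne_add_lam ha hb hc hd,
    ← formOne_add_lam ha hb hc hd, show 3 * (n + 1) + 3 = 3 * n + 6 by ring]
  ring

theorem PIL_zero (ha : 0 < a) (hb : 0 < b) (hc : 0 < c) (hd : 0 < d) {F : BorelData}
    (hq : ∀ n, q a b c d F n 1 = formOne a b c d n) : PIL a b c d F 0 0 = 1 := by
  have h := lam_two_mul_formOne ha hb hc hd
  rw [PIL, Matrix.transpose_apply, U_self, hq, dI₂_eq ha hb hc hd hq, mul_assoc, mul_zero,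
    zero_add, h]
  simp [formOne]

theorem PIL_succ (ha : 0 < a) (hb : 0 < b) (hc : 0 < c) (hd : 0 < d) {F : BorelData}
    (hq : ∀ n, q a b c d F n 1 = formOne a b c d n) (n : ℕ) :
    PIL a b c d F (n + 1) n = (n + 1) / (cPrev c d n + n + 1) := by
  rw [PIL, Matrix.transpose_apply, U_succ, hq, dI₂_eq ha hb hc hd hq,
    formOne_mul_eq_succ ha hb hc hd, mul_one, one_div,
    inv_mul_cancel_left₀ (formOne_pos ha hb hc hd _).ne']

theorem PIL_self (ha : 0 < a) (hb : 0 < b) (hc : 0 < c) (hd : 0 < d) {F : BorelData}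
    (hq : ∀ n, q a b c d F n 1 = formOne a b c d n) (n : ℕ) :
    PIL a b c d F (n + 1) (n + 1) = cPrev c d n / (cPrev c d n + n + 1) := by
  rw [PIL, Matrix.transpose_apply, U_self, hq, dI₂_eq ha hb hc hd hq, mul_assoc,
    lam_mul_formOne ha hb hc hd, one_div, inv_mul_cancel_left₀ (formOne_pos ha hb hc hd _).ne']

theorem PIU₂_self (ha : 0 < a) (hb : 0 < b) (hc : 0 < c) (hd : 0 < d) {F : BorelData}
    (hq : ∀ n, q a b c d F n 1 = formOne a b c d n) (n : ℕ) :
    PIU₂ a b c d F n n = (n + b) / (cPrev c d (n + 1) + n) := by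
  have := cPrev_pos hc hd n
  have := cPrev_pos hc hd (n + 1)
  have := formOne_pos ha hb hc hd n
  rw [PIU₂, Matrix.transpose_apply, L₂_self, dI₁_eq ha hb hc hd hq, dI₂_eq ha hb hc hd hq]
  field_simp
  ring

theorem PIU₂_succ (ha : 0 < a) (hb : 0 < b) (hc : 0 < c) (hd : 0 < d) {F : BorelData}
    (hq : ∀ n, q a b c d F n 1 = formOne a b c d n) (n : ℕ) :
    PIU₂ a b c d F n (n + 1) = (cPrev c d (n + 1) - b) / (cPrev c d (n + 1) + n) := by
  have := cPrev_pos hc hd n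
  have := cPrev_pos hc hd (n + 1)
  have := formOne_pos ha hb hc hd n
  rw [PIU₂, Matrix.transpose_apply, L₂_succ, dI₁_eq ha hb hc hd hq, dI₂_eq ha hb hc hd hq,
    -- The term containing `λ_{3n+4}` is replaced by a difference of closed forms, so `λ` need not
    -- be expanded.
    mul_assoc, eq_sub_of_add_eq' (formOne_add_lam₂ ha hb hc hd n)]
  field_simp
  ring

theorem PIU₁_self (ha : 0 < a) (hb : 0 < b) (hc : 0 < c) (hd : 0 < d) {F : BorelData}
    (hq : ∀ n, q a b c d F n 1 = formOne a b c d n) (n : ℕ) :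
    PIU₁ a b c d F n n = (n + a) / (cPrev c d n + n) := by
  have := cPrev_pos hc hd n
  have := formOne_pos ha hb hc hd n
  rw [PIU₁, Matrix.transpose_apply, L₁_self, dI₁_eq ha hb hc hd hq, hq]
  field_simp
  ring

theorem PIU₁_succ (ha : 0 < a) (hb : 0 < b) (hc : 0 < c) (hd : 0 < d) {F : BorelData}
    (hq : ∀ n, q a b c d F n 1 = formOne a b c d n) (n : ℕ) :
    PIU₁ a b c d F n (n + 1) = (cPrev c d n - a) / (cPrev c d n + n) := by
  have := cPrev_pos hc hd n
  have := formOne_pos ha hb hc hd n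
  rw [PIU₁, Matrix.transpose_apply, L₁_succ, dI₁_eq ha hb hc hd hq, hq, mul_assoc,
    eq_sub_of_add_eq' (formOne_add_lam ha hb hc hd n)]
  field_simp
  ring

theorem isPureDeath_PIL (ha : 0 < a) (hb : 0 < b) (hc : 0 < c) (hd : 0 < d) {F : BorelData}
    (hq : ∀ n, q a b c d F n 1 = formOne a b c d n) : IsPureDeath (PIL a b c d F) := by
  refine isPureDeath_of (PIL_zero ha hb hc hd hq) (fun n => ?_) (fun n => ?_) (fun n => ?_)
    fun n m h1 h2 => ?_
  · have := cPrev_pos hc hd n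
    rw [PIL_self ha hb hc hd hq]
    positivity
  · have := cPrev_pos hc hd n
    rw [PIL_succ ha hb hc hd hq]
    positivity
  · have := cPrev_pos hc hd n
    rw [PIL_succ ha hb hc hd hq, PIL_self ha hb hc hd hq]
    field_simp
    ring
  · rw [PIL, Matrix.transpose_apply, U_eq_zero _ _ _ _ _ _ h1.symm h2.symm]
    ring

theorem isPureBirth_PIU₂ (ha : 0 < a) (hb : 0 < b) (hc : 0 < c) (hd : 0 < d) (hbd : b < d)
    (hbc : b ≤ c + 1) {F : BorelData}
    (hq : ∀ n, q a b c d F n 1 = formOne a b c d n) : IsPureBirth (PIU₂ a b c d F) := by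
  refine isPureBirth_of (fun n => ?_) (fun n => ?_) (fun n => ?_) fun n m h1 h2 => ?_
  · have := cPrev_pos hc hd (n + 1)
    rw [PIU₂_self ha hb hc hd hq]
    positivity
  · have := cPrev_pos hc hd (n + 1)
    rw [PIU₂_succ ha hb hc hd hq]
    exact div_nonneg (sub_nonneg.2 (le_cPrev_succ hbc hbd.le n)) (by positivity)
  · have := cPrev_pos hc hd (n + 1)
    rw [PIU₂_succ ha hb hc hd hq, PIU₂_self ha hb hc hd hq]
    field_simp
    ring
  · rw [PIU₂, Matrix.transpose_apply, L₂_eq_zero _ _ _ _ _ _ h1.symm (Ne.symm h2)]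
    ring

theorem isPureBirth_PIU₁ (ha : 0 < a) (hb : 0 < b) (hc : 0 < c) (hd : 0 < d) (had : a < d)
    (hac : a ≤ c) {F : BorelData}
    (hq : ∀ n, q a b c d F n 1 = formOne a b c d n) : IsPureBirth (PIU₁ a b c d F) := by
  refine isPureBirth_of (fun n => ?_) (fun n => ?_) (fun n => ?_) fun n m h1 h2 => ?_
  · have := cPrev_pos hc hd n
    rw [PIU₁_self ha hb hc hd hq]
    positivity
  · have := cPrev_pos hc hd n
    rw [PIU₁_succ ha hb hc hd hq]
    exact div_nonneg (sub_nonneg.2 (le_cPrev hac had.le n)) (by positivity)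
  · have := cPrev_pos hc hd n
    rw [PIU₁_succ ha hb hc hd hq, PIU₁_self ha hb hc hd hq]
    field_simp
    ring
  · rw [PIU₁, Matrix.transpose_apply, L₁_eq_zero _ _ _ _ _ _ h1.symm (Ne.symm h2)]
    ring

/-- Transposing `J = L₁ L₂ U` gives `Uᵀ L₂ᵀ L₁ᵀ`. The diagonal matrices `D₂` and `D₁` inserted
between the factors cancel, since their entries are nonzero. -/
theorem PI_eq_semiMul (ha : 0 < a) (hb : 0 < b) (hc : 0 < c) (hd : 0 < d) {F : BorelData}
    (hFS : F.S = typeII a b c d) (hq : ∀ n, q a b c d F n 1 = formOne a b c d n) :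
    PI a b c d F = PIL a b c d F ⬝∞ PIU₂ a b c d F ⬝∞ PIU₁ a b c d F := by
  have hd1 : ∀ n, dI₁ a b c d F n ≠ 0 := fun n => by
    have := cPrev_pos hc hd n
    have := formOne_pos ha hb hc hd n
    rw [dI₁_eq ha hb hc hd hq]
    positivity
  have hd2 : ∀ n, dI₂ a b c d F n ≠ 0 := fun n => by
    have := cPrev_pos hc hd n
    have := cPrev_pos hc hd (n + 1)
    have := formOne_pos ha hb hc hd n
    rw [dI₂_eq ha hb hc hd hq]
    positivity
  have h12 := scaled_semiMul hd2 (fun n k => (rfl : PIL a b c d F n k = _))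
    (fun k m => (rfl : PIU₂ a b c d F k m = _))
  ext n m
  rw [scaled_semiMul hd1 h12 (fun k m => (rfl : PIU₁ a b c d F k m = _)), ← semiMul_transpose,
    ← semiMul_transpose, PI, jacobi_eq ha hb hc hd hFS, Matrix.transpose_apply]
  ring

end Values

end HypMOP

/-! ### The main theorem -/

theorem mainTheorem8 (a b c d : ℝ) (ha : 0 < a) (hb : 0 < b) (had : a < d) (hbd : b < d)
    (hac : a ≤ c) (hbc : b ≤ c + 1) (hperfect : ∀ k : ℕ, c - b ≠ -(k : ℝ)) :
    (∃! F : BorelData, IsGaussBorel (momentMatrix a b c d) F) ∧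
    ∀ F : BorelData, IsGaussBorel (momentMatrix a b c d) F →
      IsStochastic (PI a b c d F) ∧
      IsPureDeath (PIL a b c d F) ∧
      IsPureBirth (PIU₂ a b c d F) ∧
      IsPureBirth (PIU₁ a b c d F) ∧
      PI a b c d F = PIL a b c d F ⬝∞ PIU₂ a b c d F ⬝∞ PIU₁ a b c d F ∧
      IsAbsorbing (PIL a b c d F) 0 ∧
      (∀ n : ℕ, 1 ≤ n →
        PIL a b c d F (2 * n) (2 * n - 1) = 2 * n / (3 * n - 1 + d) ∧
        PIL a b c d F (2 * n) (2 * n) = (n - 1 + d) / (3 * n - 1 + d)) ∧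
      (∀ n : ℕ,
        PIL a b c d F (2 * n + 1) (2 * n) = (2 * n + 1) / (3 * n + 1 + c) ∧
        PIL a b c d F (2 * n + 1) (2 * n + 1) = (n + c) / (3 * n + 1 + c)) ∧
      (∀ n : ℕ,
        PIU₂ a b c d F (2 * n) (2 * n + 1) = (n + d - b) / (3 * n + d) ∧
        PIU₂ a b c d F (2 * n) (2 * n) = (2 * n + b) / (3 * n + d) ∧
        PIU₂ a b c d F (2 * n + 1) (2 * n + 2) = (n + 1 + c - b) / (3 * n + 2 + c) ∧
        PIU₂ a b c d F (2 * n + 1) (2 * n + 1) = (2 * n + 1 + b) / (3 * n + 2 + c)) ∧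
      (∀ n : ℕ,
        PIU₁ a b c d F (2 * n) (2 * n + 1) = (n + c - a) / (3 * n + c) ∧
        PIU₁ a b c d F (2 * n) (2 * n) = (2 * n + a) / (3 * n + c) ∧
        PIU₁ a b c d F (2 * n + 1) (2 * n + 2) = (n + d - a) / (3 * n + 1 + d) ∧
        PIU₁ a b c d F (2 * n + 1) (2 * n + 1) = (2 * n + 1 + a) / (3 * n + 1 + d)) := by
  have hc : 0 < c := by linarith
  have hd : 0 < d := by linarith
  have hδ : 0 < c + d - a - b := by linarith
  obtain ⟨F₀, hF₀, hS₀⟩ := exists_gaussBorel ha hb had hbd hac hperfect hδ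
  refine ⟨⟨F₀, hF₀, fun F hF => hF.eq hF₀⟩, fun F hF => ?_⟩
  -- By uniqueness any factorization is the explicit one, so its left factor is `typeII`.
  obtain rfl : F = F₀ := hF.eq hF₀
  have hq := q_one_eq ha hb hc hd hδ hF hS₀
  have hL := isPureDeath_PIL ha hb hc hd hq
  have hU₂ := isPureBirth_PIU₂ ha hb hc hd hbd hbc hq
  have hU₁ := isPureBirth_PIU₁ ha hb hc hd had hac hq
  have hfac := PI_eq_semiMul ha hb hc hd hS₀ hq
  have hLfin := rowFinite_of_lowerBidiag hL.2
  have hUfin := rowFinite_of_upperBidiag hU₂.2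
  refine ⟨?_, hL, hU₂, hU₁, hfac,
    ⟨PIL_zero ha hb hc hd hq, fun m hm => hL.2 0 m hm (by omega)⟩, ?_, ?_, ?_, ?_⟩
  · rw [hfac]
    exact (hL.1.semiMul hU₂.1 hLfin).semiMul hU₁.1 (hLfin.semiMul hUfin)
  · intro n hn
    -- This removes the truncated subtraction in the index `2 * n - 1`.
    obtain ⟨k, rfl⟩ : ∃ k, n = k + 1 := ⟨n - 1, by omega⟩
    rw [show 2 * (k + 1) = 2 * k + 1 + 1 by ring, Nat.add_sub_cancel, PIL_succ ha hb hc hd hq,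
      PIL_self ha hb hc hd hq, cPrev_odd]
    push_cast
    constructor <;> congr 1 <;> ring
  · intro n
    rw [PIL_succ ha hb hc hd hq, PIL_self ha hb hc hd hq, cPrev_even]
    push_cast
    constructor <;> congr 1 <;> ring
  · intro n
    rw [show 2 * n + 2 = 2 * n + 1 + 1 by ring, PIU₂_succ ha hb hc hd hq,
      PIU₂_self ha hb hc hd hq, PIU₂_succ ha hb hc hd hq, PIU₂_self ha hb hc hd hq,
      show 2 * n + 1 + 1 = 2 * (n + 1) by ring, cPrev_odd, cPrev_even]
    push_cast
    refine ⟨?_, ?_, ?_, ?_⟩ <;> congr 1 <;> ring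
  · intro n
    rw [show 2 * n + 2 = 2 * n + 1 + 1 by ring, PIU₁_succ ha hb hc hd hq,
      PIU₁_self ha hb hc hd hq, PIU₁_succ ha hb hc hd hq, PIU₁_self ha hb hc hd hq,
      cPrev_odd, cPrev_even]
    push_cast
    refine ⟨?_, ?_, ?_, ?_⟩ <;> congr 1 <;> ring
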